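/- Let $U_0=[0,1]^2$ and let $M_0$ be its boundary. A \emph{square set} is a set $X$ with an injective map $S_X:M_0\to X$; a morphism $f:X\to Y$ of the category $\mathsf{SquaSet}$ of square sets is a map with $f\circ S_X=S_Y$. A \emph{square metric space} is a square set $X$ which is a metric space with all distances at most $2$ such that $d_X(S_X(i,r),S_X(i,s))=|r-s|=d_X(S_X(r,i),S_X(s,i))$ for $i\in\{0,1\}$, $r,s\in[0,1]$, and $d_X(S_X(r,s),S_X(t,u))\ge|r-t|+|s-u|$ for all $(r,s),(t,u)\in M_0$; morphisms of the category $\mathsf{SquaMS}$ are the morphisms of square sets which are short, i.e. do not increase distances. Let $M=\{0,1,2\}^2\setminus\{(1,1)\}$ and $\sigma_m(p)=\frac13(m+p)$ for $m\in M$, $p\in U_0$. For a square set $X$ let $M\otimes X=(M\times X)/{\sim}$, where $\sim$ is the equivalence relation generated by gluing adjacent sides, i.e. for $r\in[0,1]$ by $((0,0),S_X(r,1))\sim((0,1),S_X(r,0))$, $((0,1),S_X(r,1))\sim((0,2),S_X(r,0))$, $((0,2),S_X(1,r))\sim((1,2),S_X(0,r))$, $((1,2),S_X(1,r))\sim((2,2),S_X(0,r))$,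 $((2,2),S_X(r,0))\sim((2,1),S_X(r,1))$, $((2,1),S_X(r,0))\sim((2,0),S_X(r,1))$, $((2,0),S_X(0,r))\sim((1,0),S_X(1,r))$, $((1,0),S_X(0,r))\sim((0,0),S_X(1,r))$. Write $m\otimes x$ for the class of $(m,x)$. Then $M\otimes X$ is a square set by $S_{M\otimes X}(\sigma_m(w))=m\otimes S_X(w)$ (for $m\in M$ and $w\in M_0$ with $\sigma_m(w)\in M_0$), and $M\otimes-$ is an endofunctor of $\mathsf{SquaSet}$ by $(M\otimes f)(m\otimes x)=m\otimes f(x)$. It is also an endofunctor of $\mathsf{SquaMS}$: the distance of $m\otimes x$ and $n\otimes y$ is the infimum of the scores of all finite paths in $M\times X$ from $(m,x)$ to $(n,y)$, where the score of a path is the sum of the contributions of its pairs of consecutive entries, and a pair $(k,a),(l,b)$ contributes $0$ if $(k,a)\sim(l,b)$, and otherwise $\frac13d_X(a,b)$ if $k=l$ and $2$ if $k\ne l$. Let $\mathbb S$ be the Sierpinski carpet, the unique non-empty compact subset of $U_0$ with $\mathbb S=\bigcup_{m\in M}\sigma_m(\mathbb S)$; it is a square set by the inclusion $M_0\subseteq\mathbb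 S$. The map $\tau:M\otimes\mathbb S\to\mathbb S$, $\tau(m\otimes s)=\sigma_m(s)$, is an isomorphism of square sets. Let $(G,\eta:M\otimes G\to G)$ be an initial algebra of $M\otimes-:\mathsf{SquaMS}\to\mathsf{SquaMS}$ (it is unique up to isomorphism, and $\eta$ is invertible), let $Q=C(G)$ be the Cauchy completion of $G$, with $S_Q$ the composite of $S_G$ with $G\to C(G)$, and let $\gamma:Q\to M\otimes Q$ be the composite of $C(\eta^{-1}):C(G)\to C(M\otimes G)$ with the inverse of the isomorphism $M\otimes C(G)\to C(M\otimes G)$, $m\otimes\lim_k x_k\mapsto\lim_k(m\otimes x_k)$. Then the following hold. 1. $(\mathbb S,\tau^{-1})$ is a final coalgebra of $M\otimes-:\mathsf{SquaSet}\to\mathsf{SquaSet}$. 2. An initial algebra $(G,\eta)$ as above exists, and (forgetting the metric) the resulting $(Q,\gamma)$ is a final coalgebra of $M\otimes-:\mathsf{SquaSet}\to\mathsf{SquaSet}$. -/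

import Mathlib

namespace SquareSets

open CategoryTheory
open scoped NNReal

noncomputable section

/-! ## The unit square, its boundary, and the eight contractions -/

/-- The unit square `U₀ = [0,1]²`. -/
def unitSquare : Set (ℝ × ℝ) := {p | p.1 ∈ Set.Icc (0 : ℝ) 1 ∧ p.2 ∈ Set.Icc (0 : ℝ) 1}

/-- The boundary `M₀` of the unit square. -/
def boundary : Set (ℝ × ℝ) :=
  {p | (p.1 = 0 ∨ p.1 = 1) ∧ p.2 ∈ Set.Icc (0 : ℝ) 1} ∪
    {p | p.1 ∈ Set.Icc (0 : ℝ) 1 ∧ (p.2 = 0 ∨ p.2 = 1)}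

/-- `M₀` as a type. -/
abbrev M0 : Type := boundary

/-- The point `(0, r)` of `M₀`. -/
def left (r : unitInterval) : M0 := ⟨(0, r), Or.inl ⟨Or.inl rfl, r.2⟩⟩

/-- The point `(1, r)` of `M₀`. -/
def right (r : unitInterval) : M0 := ⟨(1, r), Or.inl ⟨Or.inr rfl, r.2⟩⟩

/-- The point `(r, 0)` of `M₀`. -/
def bottom (r : unitInterval) : M0 := ⟨(r, 0), Or.inr ⟨r.2, Or.inl rfl⟩⟩

/-- The point `(r, 1)` of `M₀`. -/
def top (r : unitInterval) : M0 := ⟨(r, 1), Or.inr ⟨r.2, Or.inr rfl⟩⟩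

/-- The index set `M = {0,1,2}² \ {(1,1)}`; an index is a pair (column, row). -/
abbrev Idx : Type := {m : Fin 3 × Fin 3 // m ≠ (1, 1)}

/-- The contraction `σ_m(p) = shrink(m) + p/3`, where `shrink (i, j) = (i/3, j/3)`. -/
def contract (m : Idx) (p : ℝ × ℝ) : ℝ × ℝ :=
  (((m.1.1 : ℕ) : ℝ) / 3 + p.1 / 3, ((m.1.2 : ℕ) : ℝ) / 3 + p.2 / 3)

/-- The taxicab distance on the plane. -/
def taxi (p q : ℝ × ℝ) : ℝ := |p.1 - q.1| + |p.2 - q.2|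

/-- The generating identifications between points of `M × M₀`. -/
inductive Glue : Idx × M0 → Idx × M0 → Prop
  | g1 (r : unitInterval) : Glue (⟨(0, 0), by decide⟩, top r) (⟨(0, 1), by decide⟩, bottom r)
  | g2 (r : unitInterval) : Glue (⟨(0, 1), by decide⟩, top r) (⟨(0, 2), by decide⟩, bottom r)
  | g3 (r : unitInterval) : Glue (⟨(0, 2), by decide⟩, right r) (⟨(1, 2), by decide⟩, left r)
  | g4 (r : unitInterval) : Glue (⟨(1, 2), by decide⟩, right r) (⟨(2, 2), by decide⟩, left r)
  | g5 (r : unitInterval) : Glue (⟨(2, 2), by decide⟩, bottom r) (⟨(2, 1), by decide⟩, top r)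
  | g6 (r : unitInterval) : Glue (⟨(2, 1), by decide⟩, bottom r) (⟨(2, 0), by decide⟩, top r)
  | g7 (r : unitInterval) : Glue (⟨(2, 0), by decide⟩, left r) (⟨(1, 0), by decide⟩, right r)
  | g8 (r : unitInterval) : Glue (⟨(1, 0), by decide⟩, left r) (⟨(0, 0), by decide⟩, right r)

theorem boundary_subset : boundary ⊆ unitSquare := by
  rintro ⟨x, y⟩ (⟨h | h, h'⟩ | ⟨h', h | h⟩) <;> simp_all [unitSquare]

theorem contract_mem (m : Idx) {p : ℝ × ℝ} (hp : p ∈ unitSquare) : contract m p ∈ unitSquare := by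
  obtain ⟨⟨i, j⟩, hm⟩ := m
  obtain ⟨⟨h1, h2⟩, h3, h4⟩ := hp
  have hi : ((i : ℕ) : ℝ) ≤ 2 := by exact_mod_cast Nat.le_of_lt_succ i.2
  have hj : ((j : ℕ) : ℝ) ≤ 2 := by exact_mod_cast Nat.le_of_lt_succ j.2
  have hi0 : (0 : ℝ) ≤ ((i : ℕ) : ℝ) := Nat.cast_nonneg _
  have hj0 : (0 : ℝ) ≤ ((j : ℕ) : ℝ) := Nat.cast_nonneg _
  refine ⟨⟨?_, ?_⟩, ?_, ?_⟩ <;> simp only [contract] <;> linarith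

theorem Glue.contract_eq {p q : Idx × M0} (h : Glue p q) :
    contract p.1 p.2 = contract q.1 q.2 := by
  cases h <;> simp [contract, left, right, top, bottom] <;> norm_num

theorem contract_injective (m : Idx) : Function.Injective (contract m) := by
  intro p q h
  simp only [contract, Prod.mk.injEq] at h
  exact Prod.ext (by linarith [h.1]) (by linarith [h.2])

/-- Two coordinates in adjacent or equal columns (rows) of the grid. -/
theorem coord_cases {i k : Fin 3} {x t : ℝ} (hx : x ∈ Set.Icc (0 : ℝ) 1)
    (ht : t ∈ Set.Icc (0 : ℝ) 1)
    (h : ((i : ℕ) : ℝ) / 3 + x / 3 = ((k : ℕ) : ℝ) / 3 + t / 3) :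
    (i = k ∧ x = t) ∨ ((k : ℕ) = i + 1 ∧ x = 1 ∧ t = 0) ∨ ((i : ℕ) = k + 1 ∧ x = 0 ∧ t = 1) := by
  obtain ⟨hx0, hx1⟩ := hx
  obtain ⟨ht0, ht1⟩ := ht
  fin_cases i <;> fin_cases k <;> norm_num at h ⊢ <;>
    first | linarith | exact ⟨by linarith, by linarith⟩

open Relation in
theorem eqvGen_glue_iff {p q : Idx × M0} :
    EqvGen Glue p q ↔ contract p.1 p.2 = contract q.1 q.2 := by
  constructor
  · intro h
    induction h with
    | rel _ _ h => exact h.contract_eq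
    | refl _ => rfl
    | symm _ _ _ ih => exact ih.symm
    | trans _ _ _ _ _ ih1 ih2 => exact ih1.trans ih2
  · intro h
    obtain ⟨⟨⟨i, j⟩, hm⟩, ⟨⟨x, y⟩, hz⟩⟩ := p
    obtain ⟨⟨⟨k, l⟩, hn⟩, ⟨⟨t, u⟩, hw⟩⟩ := q
    have hz' := boundary_subset hz
    have hw' := boundary_subset hw
    simp only [contract, Prod.mk.injEq] at h
    have hs : ∀ {a b}, Glue a b → EqvGen Glue a b := fun h => EqvGen.rel _ _ h
    have hs' : ∀ {a b}, Glue a b → EqvGen Glue b a := fun h => EqvGen.symm _ _ (EqvGen.rel _ _ h)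
    have ht : ∀ {a b c}, EqvGen Glue a b → EqvGen Glue b c → EqvGen Glue a c :=
      fun h1 h2 => EqvGen.trans _ _ _ h1 h2
    rcases coord_cases hz'.1 hw'.1 h.1 with ⟨rfl, rfl⟩ | ⟨e, rfl, rfl⟩ | ⟨e, rfl, rfl⟩ <;>
    rcases coord_cases hz'.2 hw'.2 h.2 with ⟨rfl, rfl⟩ | ⟨e', rfl, rfl⟩ | ⟨e', rfl, rfl⟩
    · exact EqvGen.refl _
    · fin_cases i <;> fin_cases j <;> fin_cases l <;> simp at e' hm hn
      · exact hs (.g1 ⟨x, hz'.1⟩)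
      · exact hs (.g2 ⟨x, hz'.1⟩)
      · exact hs' (.g6 ⟨x, hz'.1⟩)
      · exact hs' (.g5 ⟨x, hz'.1⟩)
    · fin_cases i <;> fin_cases j <;> fin_cases l <;> simp at e' hm hn
      · exact hs' (.g1 ⟨x, hz'.1⟩)
      · exact hs' (.g2 ⟨x, hz'.1⟩)
      · exact hs (.g6 ⟨x, hz'.1⟩)
      · exact hs (.g5 ⟨x, hz'.1⟩)
    · fin_cases i <;> fin_cases j <;> fin_cases k <;> simp at e hm hn
      · exact hs' (.g8 ⟨y, hz'.2⟩)
      · exact hs (.g3 ⟨y, hz'.2⟩)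
      · exact hs' (.g7 ⟨y, hz'.2⟩)
      · exact hs (.g4 ⟨y, hz'.2⟩)
    · fin_cases i <;> fin_cases j <;> fin_cases k <;> fin_cases l <;> simp at e e' hm hn
      · exact ht (hs (.g2 1)) (hs (.g3 0))
      · exact ht (hs' (.g7 1)) (hs' (.g6 0))
    · fin_cases i <;> fin_cases j <;> fin_cases k <;> fin_cases l <;> simp at e e' hm hn
      · exact ht (hs' (.g1 1)) (hs' (.g8 1))
      · exact ht (hs (.g4 0)) (hs (.g5 0))
    · fin_cases i <;> fin_cases j <;> fin_cases k <;> simp at e hm hn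
      · exact hs (.g8 ⟨y, hz'.2⟩)
      · exact hs' (.g3 ⟨y, hz'.2⟩)
      · exact hs (.g7 ⟨y, hz'.2⟩)
      · exact hs' (.g4 ⟨y, hz'.2⟩)
    · fin_cases i <;> fin_cases j <;> fin_cases k <;> fin_cases l <;> simp at e e' hm hn
      · exact ht (hs (.g8 1)) (hs (.g1 1))
      · exact ht (hs' (.g5 0)) (hs' (.g4 0))
    · fin_cases i <;> fin_cases j <;> fin_cases k <;> fin_cases l <;> simp at e e' hm hn
      · exact ht (hs' (.g3 0)) (hs' (.g2 1))
      · exact ht (hs (.g6 0)) (hs (.g7 1))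

/-! ## Square sets and the functor `M ⊗ -` -/

/-- A square set: a set `X` with an injective map `S_X : M₀ → X`. -/
structure SquaSet where
  carrier : Type
  S : M0 → carrier
  S_injective : Function.Injective S

namespace SquaSet

/-- Morphisms of square sets: maps preserving the designated boundary. -/
@[ext]
structure Hom (X Y : SquaSet) where
  toFun : X.carrier → Y.carrier
  map_S : ∀ z, toFun (X.S z) = Y.S z

instance : Category SquaSet where
  Hom := Hom
  id X := ⟨fun x => x, fun _ => rfl⟩
  comp f g := ⟨fun x => g.toFun (f.toFun x), fun z => by rw [f.map_S, g.map_S]⟩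

@[ext]
theorem hom_ext {X Y : SquaSet} {f g : X ⟶ Y} (h : ∀ x, f.toFun x = g.toFun x) : f = g :=
  Hom.ext (funext h)

/-- The relation `(m, S_X z) ≈ (n, S_X w)` for `(m, z)`, `(n, w)` in the gluing relation. -/
def GlueRel (X : SquaSet) (p q : Idx × X.carrier) : Prop :=
  ∃ m z n w, Glue (m, z) (n, w) ∧ p = (m, X.S z) ∧ q = (n, X.S w)

/-- The equivalence relation `∼` on `M × X` generated by `≈`. -/
def glueSetoid (X : SquaSet) : Setoid (Idx × X.carrier) := Relation.EqvGen.setoid X.GlueRel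

/-- The underlying set `M ⊗ X = (M × X)/∼`. -/
def Tensor (X : SquaSet) : Type := Quotient X.glueSetoid

/-- The class `m ⊗ x`. -/
def tmk (X : SquaSet) (m : Idx) (x : X.carrier) : X.Tensor := Quotient.mk X.glueSetoid (m, x)

theorem glueSetoid_iff (X : SquaSet) {p q : Idx × X.carrier} :
    X.glueSetoid.r p q ↔
      p = q ∨ ∃ z w, p.2 = X.S z ∧ q.2 = X.S w ∧ contract p.1 z = contract q.1 w := by
  constructor
  · intro h
    replace h : Relation.EqvGen X.GlueRel p q := h
    induction h with
    | rel p q h =>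
      obtain ⟨m, z, n, w, h, rfl, rfl⟩ := h
      exact Or.inr ⟨z, w, rfl, rfl, h.contract_eq⟩
    | refl p => exact Or.inl rfl
    | symm p q _ ih =>
      rcases ih with rfl | ⟨z, w, h1, h2, h3⟩
      · exact Or.inl rfl
      · exact Or.inr ⟨w, z, h2, h1, h3.symm⟩
    | trans p q r _ _ ih ih' =>
      rcases ih with rfl | ⟨z, w, h1, h2, h3⟩
      · exact ih'
      · rcases ih' with rfl | ⟨z', w', h1', h2', h3'⟩
        · exact Or.inr ⟨z, w, h1, h2, h3⟩
        · obtain rfl : w = z' := X.S_injective (h2.symm.trans h1')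
          exact Or.inr ⟨z, w', h1, h2', h3.trans h3'⟩
  · rintro (rfl | ⟨z, w, h1, h2, h3⟩)
    · exact Relation.EqvGen.refl _
    · obtain ⟨m, x⟩ := p
      obtain ⟨n, y⟩ := q
      dsimp only at h1 h2 h3
      subst h1 h2
      have h4 : Relation.EqvGen Glue (m, z) (n, w) := eqvGen_glue_iff.2 h3
      have key : ∀ a b, Relation.EqvGen Glue a b →
          Relation.EqvGen X.GlueRel (a.1, X.S a.2) (b.1, X.S b.2) := by
        intro a b hab
        induction hab with
        | rel a b h => exact .rel _ _ ⟨a.1, a.2, b.1, b.2, h, rfl, rfl⟩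
        | refl a => exact .refl _
        | symm _ _ _ ih => exact .symm _ _ ih
        | trans _ _ _ _ _ ih ih' => exact .trans _ _ _ ih ih'
      exact key _ _ h4

theorem tmk_eq_iff (X : SquaSet) {m n : Idx} {x y : X.carrier} :
    X.tmk m x = X.tmk n y ↔
      (m = n ∧ x = y) ∨ ∃ z w, x = X.S z ∧ y = X.S w ∧ contract m z = contract n w := by
  refine (Quotient.eq (r := X.glueSetoid)).trans (X.glueSetoid_iff.trans ?_)
  simp

end SquaSet

/-- The column (row) `0`, `1` or `2` of the `3 × 3` grid which contains the coordinate `x`. -/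
def third (x : ℝ) : Fin 3 := if x ≤ 1 / 3 then 0 else if x ≤ 2 / 3 then 1 else 2

theorem third_zero : third 0 = 0 := by simp [third]

theorem third_one : third 1 = 2 := by norm_num [third]

theorem three_mul_sub_third {x : ℝ} (hx : x ∈ Set.Icc (0 : ℝ) 1) :
    3 * x - ((third x : ℕ) : ℝ) ∈ Set.Icc (0 : ℝ) 1 := by
  obtain ⟨h0, h1⟩ := hx
  unfold third
  split_ifs <;> norm_num <;> constructor <;> linarith

/-- An index `m` of a small square having the boundary point `z` on its outer side. -/
def idxOf (z : M0) : Idx :=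
  ⟨(third z.1.1, third z.1.2), by
    obtain ⟨⟨x, y⟩, (⟨h | h, -⟩ | ⟨-, h | h⟩)⟩ := z <;> simp only at h <;> subst h <;>
      simp [third_zero, third_one]⟩

/-- The position of the boundary point `z` in the small square with index `idxOf z`. -/
def localOf (z : M0) : M0 :=
  ⟨(3 * z.1.1 - ((third z.1.1 : ℕ) : ℝ), 3 * z.1.2 - ((third z.1.2 : ℕ) : ℝ)), by
    obtain ⟨⟨x, y⟩, (⟨h | h, h'⟩ | ⟨h', h | h⟩)⟩ := z <;> simp only at h h' <;> subst h
    · exact Or.inl ⟨Or.inl (by simp [third_zero]), three_mul_sub_third h'⟩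
    · exact Or.inl ⟨Or.inr (by norm_num [third_one]), three_mul_sub_third h'⟩
    · exact Or.inr ⟨three_mul_sub_third h', Or.inl (by simp [third_zero])⟩
    · exact Or.inr ⟨three_mul_sub_third h', Or.inr (by norm_num [third_one])⟩⟩

theorem contract_localOf (z : M0) : contract (idxOf z) (localOf z) = z := by
  simp only [contract, idxOf, localOf]
  ext <;> simp only <;> ring

namespace SquaSet

/-- The map `S_{M ⊗ X}`: each side of `M ⊗ X` consists of three copies of the corresponding side of
`X`; for example `(r, 0) ↦ (1, 0) ⊗ S_X (3r - 1, 0)` for `1/3 ≤ r ≤ 2/3`. -/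
def tensorS (X : SquaSet) (z : M0) : X.Tensor := X.tmk (idxOf z) (X.S (localOf z))

/-- The map `S_{M ⊗ X}` does not depend on the choices made at the common end points of the
thirds of the sides: it is characterized by `S_{M ⊗ X} (σ_m w) = m ⊗ S_X w`. -/
theorem tensorS_eq (X : SquaSet) {z w : M0} {m : Idx} (h : contract m w = z) :
    X.tensorS z = X.tmk m (X.S w) :=
  X.tmk_eq_iff.2 (Or.inr ⟨_, _, rfl, rfl, (contract_localOf z).trans h.symm⟩)

theorem tensorS_injective (X : SquaSet) : Function.Injective X.tensorS := by
  intro z w h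
  have key : contract (idxOf z) (localOf z) = contract (idxOf w) (localOf w) := by
    rcases X.tmk_eq_iff.1 h with ⟨h1, h2⟩ | ⟨a, b, h1, h2, h3⟩
    · rw [h1, X.S_injective h2]
    · rwa [X.S_injective h1, X.S_injective h2]
  rw [contract_localOf, contract_localOf] at key
  exact Subtype.ext key

/-- The square set `M ⊗ X`. -/
def tensorObj (X : SquaSet) : SquaSet := ⟨X.Tensor, X.tensorS, X.tensorS_injective⟩

/-- The map `M ⊗ f : m ⊗ x ↦ m ⊗ f(x)`. -/
def tensorMap {X Y : SquaSet} (f : X ⟶ Y) : X.tensorObj ⟶ Y.tensorObj where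
  toFun := Quotient.lift (fun p : Idx × X.carrier => Y.tmk p.1 (f.toFun p.2)) (by
    rintro ⟨m, x⟩ ⟨n, y⟩ h
    rcases X.glueSetoid_iff.1 h with h | ⟨z, w, h1, h2, h3⟩
    · rw [h]
    · refine Y.tmk_eq_iff.2 (Or.inr ⟨z, w, ?_, ?_, h3⟩)
      · simp only at h1 ⊢
        rw [h1, f.map_S]
      · simp only at h2 ⊢
        rw [h2, f.map_S])
  map_S z := by
    change Y.tmk _ (f.toFun (X.S _)) = Y.tmk _ (Y.S _)
    rw [f.map_S]

/-- The endofunctor `M ⊗ -` on square sets. -/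
def tensor : SquaSet ⥤ SquaSet where
  obj := tensorObj
  map := tensorMap
  map_id X := by
    ext x
    induction x using Quotient.inductionOn with | h p => rfl
  map_comp f g := by
    ext x
    induction x using Quotient.inductionOn with | h p => rfl

end SquaSet

/-! ## Square metric spaces and the functor `M ⊗ -` on them -/

/-- A square metric space: a square set which is a metric space bounded by `2`, such that along each
side distances coincide with distances on the unit interval (`sq1`), and distances of boundary
points are bounded below by the taxicab distance (`sq2`). -/
structure SquaMS extends SquaSet where
  [metric : MetricSpace carrier]
  dist_le_two : ∀ x y : carrier, dist x y ≤ 2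
  sq1_left : ∀ r s : unitInterval, dist (S (left r)) (S (left s)) = |(s : ℝ) - r|
  sq1_right : ∀ r s : unitInterval, dist (S (right r)) (S (right s)) = |(s : ℝ) - r|
  sq1_bottom : ∀ r s : unitInterval, dist (S (bottom r)) (S (bottom s)) = |(s : ℝ) - r|
  sq1_top : ∀ r s : unitInterval, dist (S (top r)) (S (top s)) = |(s : ℝ) - r|
  sq2 : ∀ z w : M0, taxi z w ≤ dist (S z) (S w)

attribute [instance] SquaMS.metric

namespace SquaMS

/-- Morphisms of square metric spaces: short maps preserving the designated boundary. -/
structure Hom (X Y : SquaMS) extends SquaSet.Hom X.toSquaSet Y.toSquaSet where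
  short : ∀ x y, dist (toFun x) (toFun y) ≤ dist x y

instance : Category SquaMS where
  Hom := Hom
  id X := ⟨⟨fun x => x, fun _ => rfl⟩, fun _ _ => le_rfl⟩
  comp f g := ⟨⟨fun x => g.toFun (f.toFun x), fun z => by rw [f.map_S, g.map_S]⟩,
    fun x y => (g.short _ _).trans (f.short _ _)⟩

@[ext]
theorem hom_ext {X Y : SquaMS} {f g : X ⟶ Y} (h : ∀ x, f.toFun x = g.toFun x) : f = g := by
  obtain ⟨⟨f, _⟩, _⟩ := f
  obtain ⟨⟨g, _⟩, _⟩ := g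
  obtain rfl : f = g := funext h
  rfl

/-- The functor forgetting the metric. -/
def forgetMetric : SquaMS ⥤ SquaSet where
  obj X := X.toSquaSet
  map f := f.toHom

open Classical in
/-- The contribution to the score of a path of two consecutive entries `p`, `q` of `M × X`: it is
`0` if `p ∼ q`; otherwise it is their distance in `M × X`, which is `d_X / 3` inside one copy of `X`
and `2` between different copies. -/
def stepScore (X : SquaMS) (p q : Idx × X.carrier) : ℝ≥0 :=
  if X.glueSetoid.r p q then 0 else if p.1 = q.1 then nndist p.2 q.2 / 3 else 2

theorem stepScore_self (X : SquaMS) (p : Idx × X.carrier) : X.stepScore p p = 0 :=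
  if_pos (X.glueSetoid.refl p)

theorem stepScore_comm (X : SquaMS) (p q : Idx × X.carrier) :
    X.stepScore p q = X.stepScore q p := by
  have h : X.glueSetoid.r p q ↔ X.glueSetoid.r q p := ⟨X.glueSetoid.symm, X.glueSetoid.symm⟩
  unfold stepScore
  rw [nndist_comm p.2 q.2]
  by_cases h' : X.glueSetoid.r p q
  · rw [if_pos h', if_pos (h.1 h')]
  · rw [if_neg h', if_neg (fun e => h' (h.2 e))]
    simp only [eq_comm]

/-- The score of the path `p, l₁, …, lₖ, q` in `M × X`. -/
def score (X : SquaMS) (p : Idx × X.carrier) (l : List (Idx × X.carrier)) (q : Idx × X.carrier) :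
    ℝ≥0 :=
  (List.zipWith X.stepScore (p :: l) (l ++ [q])).sum

/-- The infimum of the scores of all finite paths in `M × X` from `p` to `q`. -/
def pathDist (X : SquaMS) (p q : Idx × X.carrier) : ℝ :=
  ((⨅ l : List (Idx × X.carrier), X.score p l q : ℝ≥0) : ℝ)

/-- The path distance as a pseudometric. -/
abbrev pathMetric (X : SquaMS) : PseudoMetricSpace (Idx × X.carrier) :=
  PseudoMetricSpace.ofPreNNDist X.stepScore X.stepScore_self X.stepScore_comm

theorem pathDist_self (X : SquaMS) (p : Idx × X.carrier) : X.pathDist p p = 0 :=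
  X.pathMetric.dist_self p

theorem pathDist_comm (X : SquaMS) (p q : Idx × X.carrier) : X.pathDist p q = X.pathDist q p :=
  X.pathMetric.dist_comm p q

theorem pathDist_triangle (X : SquaMS) (p q r : Idx × X.carrier) :
    X.pathDist p r ≤ X.pathDist p q + X.pathDist q r :=
  X.pathMetric.dist_triangle p q r

theorem pathDist_le_step (X : SquaMS) (p q : Idx × X.carrier) :
    X.pathDist p q ≤ X.stepScore p q :=
  PseudoMetricSpace.dist_ofPreNNDist_le X.stepScore X.stepScore_self X.stepScore_comm p q

theorem pathDist_nonneg (X : SquaMS) (p q : Idx × X.carrier) : 0 ≤ X.pathDist p q :=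
  NNReal.coe_nonneg _

theorem pathDist_eq_zero (X : SquaMS) {p q : Idx × X.carrier} (h : X.glueSetoid.r p q) :
    X.pathDist p q = 0 := by
  refine le_antisymm ((X.pathDist_le_step p q).trans ?_) (X.pathDist_nonneg p q)
  simp [stepScore, h]

theorem pathDist_congr (X : SquaMS) {p p' q q' : Idx × X.carrier} (hp : X.glueSetoid.r p p')
    (hq : X.glueSetoid.r q q') : X.pathDist p q = X.pathDist p' q' := by
  have h1 := X.pathDist_eq_zero hp
  have h2 := X.pathDist_eq_zero hq
  have h1' := X.pathDist_eq_zero (X.glueSetoid.symm hp)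
  have h2' := X.pathDist_eq_zero (X.glueSetoid.symm hq)
  linarith [X.pathDist_triangle p p' q, X.pathDist_triangle p' q' q,
    X.pathDist_triangle p' p q', X.pathDist_triangle p q q']

theorem pathDist_le_two (X : SquaMS) (p q : Idx × X.carrier) : X.pathDist p q ≤ 2 := by
  refine (X.pathDist_le_step p q).trans ?_
  unfold stepScore
  have := X.dist_le_two p.2 q.2
  split_ifs <;> push_cast <;> linarith

theorem pathDist_same_le (X : SquaMS) (m : Idx) (x y : X.carrier) :
    X.pathDist (m, x) (m, y) ≤ dist x y / 3 := by
  refine (X.pathDist_le_step _ _).trans ?_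
  unfold stepScore
  have : 0 ≤ dist x y := dist_nonneg
  split_ifs with h1 h2
  · push_cast; linarith
  · simp
  · exact absurd rfl h2

/-- A map on `M ⊗ X` which contracts distances in each copy by `3` is short. -/
theorem le_pathDist (X : SquaMS) {Z : Type} [PseudoMetricSpace Z] (f : X.Tensor → Z)
    (hsame : ∀ m x y, dist (f (X.tmk m x)) (f (X.tmk m y)) ≤ dist x y / 3)
    (htwo : ∀ a b, dist (f a) (f b) ≤ 2) (p q : Idx × X.carrier) :
    dist (f (X.tmk p.1 p.2)) (f (X.tmk q.1 q.2)) ≤ X.pathDist p q := by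
  have hstep : ∀ p q : Idx × X.carrier,
      dist (f (X.tmk p.1 p.2)) (f (X.tmk q.1 q.2)) ≤ X.stepScore p q := by
    rintro ⟨m, x⟩ ⟨n, y⟩
    unfold stepScore
    split_ifs with h1 h2
    · have : X.tmk m x = X.tmk n y := Quotient.sound h1
      simp [this]
    · simp only at h2
      subst h2
      simpa using hsame m x y
    · exact htwo _ _
  rw [pathDist, NNReal.coe_iInf]
  refine le_ciInf fun l => ?_
  induction l generalizing p with
  | nil => simpa [score] using hstep p q
  | cons r l ih =>
    have h1 := ih r
    have h2 := hstep p r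
    have h3 : X.score p (r :: l) q = X.stepScore p r + X.score r l q := by
      simp [score]
    rw [h3, NNReal.coe_add]
    exact (dist_triangle _ _ _).trans (add_le_add h2 h1)

theorem taxi_contract (m : Idx) (p q : ℝ × ℝ) :
    taxi (contract m p) (contract m q) = taxi p q / 3 := by
  have h : ∀ a b c : ℝ, |a / 3 + b / 3 - (a / 3 + c / 3)| = |b - c| / 3 := by
    intro a b c
    rw [show a / 3 + b / 3 - (a / 3 + c / 3) = (b - c) / 3 by ring, abs_div]
    norm_num
  simp only [taxi, contract, h]
  ring

theorem taxi_comm (p q : ℝ × ℝ) : taxi p q = taxi q p := by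
  simp only [taxi, abs_sub_comm]

theorem taxi_triangle (p q r : ℝ × ℝ) : taxi p r ≤ taxi p q + taxi q r := by
  simp only [taxi]
  linarith [abs_sub_le p.1 q.1 r.1, abs_sub_le p.2 q.2 r.2]

theorem taxi_nonneg (p q : ℝ × ℝ) : 0 ≤ taxi p q := by
  unfold taxi
  positivity

theorem taxi_le_two {p q : ℝ × ℝ} (hp : p ∈ unitSquare) (hq : q ∈ unitSquare) : taxi p q ≤ 2 := by
  obtain ⟨⟨_, _⟩, _, _⟩ := hp
  obtain ⟨⟨_, _⟩, _, _⟩ := hq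
  unfold taxi
  have h1 : |p.1 - q.1| ≤ 1 := abs_le.2 ⟨by linarith, by linarith⟩
  have h2 : |p.2 - q.2| ≤ 1 := abs_le.2 ⟨by linarith, by linarith⟩
  linarith

theorem eq_of_taxi_eq_zero {p q : ℝ × ℝ} (h : taxi p q = 0) : p = q := by
  unfold taxi at h
  have h1 : |p.1 - q.1| = 0 := by linarith [abs_nonneg (p.1 - q.1), abs_nonneg (p.2 - q.2)]
  have h2 : |p.2 - q.2| = 0 := by linarith [abs_nonneg (p.1 - q.1), abs_nonneg (p.2 - q.2)]
  exact Prod.ext (sub_eq_zero.1 (abs_eq_zero.1 h1)) (sub_eq_zero.1 (abs_eq_zero.1 h2))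

/-- Every boundary point lies on one of the four sides. -/
theorem side_cases (z : M0) :
    (∃ r, z = left r) ∨ (∃ r, z = right r) ∨ (∃ r, z = bottom r) ∨ (∃ r, z = top r) := by
  obtain ⟨⟨x, y⟩, (⟨h | h, h'⟩ | ⟨h', h | h⟩)⟩ := z <;> simp only at h h' <;> subst h
  · exact Or.inl ⟨⟨y, h'⟩, rfl⟩
  · exact Or.inr (Or.inl ⟨⟨y, h'⟩, rfl⟩)
  · exact Or.inr (Or.inr (Or.inl ⟨⟨x, h'⟩, rfl⟩))
  · exact Or.inr (Or.inr (Or.inr ⟨⟨x, h'⟩, rfl⟩))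

theorem dist_S_le (X : SquaMS) (z w : M0) : dist (X.S z) (X.S w) ≤ 2 * taxi z w := by
  have c1 : left 0 = bottom 0 := rfl
  have c2 : left 1 = top 0 := rfl
  have c3 : right 0 = bottom 1 := rfl
  have c4 : right 1 = top 1 := rfl
  have htwo := X.dist_le_two
  rcases side_cases z with ⟨r, rfl⟩ | ⟨r, rfl⟩ | ⟨r, rfl⟩ | ⟨r, rfl⟩ <;>
  rcases side_cases w with ⟨s, rfl⟩ | ⟨s, rfl⟩ | ⟨s, rfl⟩ | ⟨s, rfl⟩
  · rw [X.sq1_left]; simp [taxi, left, abs_sub_comm (s : ℝ)]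
    linarith [abs_nonneg ((r : ℝ) - s)]
  · refine (htwo _ _).trans ?_; simp [taxi, left, right]
  · have h := dist_triangle (X.S (left r)) (X.S (left 0)) (X.S (bottom s))
    rw [X.sq1_left, c1, X.sq1_bottom] at h
    refine h.trans ?_
    have := r.2.1; have := s.2.1
    simp [taxi, left, bottom]
    rw [abs_of_nonneg, abs_of_nonneg] <;> linarith
  · have h := dist_triangle (X.S (left r)) (X.S (left 1)) (X.S (top s))
    rw [X.sq1_left, c2, X.sq1_top] at h
    refine h.trans ?_
    have := r.2.1; have := s.2.1
    simp [taxi, left, top, abs_sub_comm (r : ℝ)]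
    rw [abs_of_nonneg (a := (s : ℝ))] <;> linarith [abs_nonneg (1 - (r : ℝ))]
  · refine (htwo _ _).trans ?_; simp [taxi, left, right]
  · rw [X.sq1_right]; simp [taxi, right, abs_sub_comm (s : ℝ)]
    linarith [abs_nonneg ((r : ℝ) - s)]
  · have h := dist_triangle (X.S (right r)) (X.S (right 0)) (X.S (bottom s))
    rw [X.sq1_right, c3, X.sq1_bottom] at h
    refine h.trans ?_
    have := r.2.1; have := s.2.1
    simp [taxi, right, bottom, abs_sub_comm (s : ℝ)]
    rw [abs_of_nonneg (a := (r : ℝ))] <;> linarith [abs_nonneg (1 - (s : ℝ))]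
  · have h := dist_triangle (X.S (right r)) (X.S (right 1)) (X.S (top s))
    rw [X.sq1_right, c4, X.sq1_top] at h
    refine h.trans ?_
    simp [taxi, right, top, abs_sub_comm (s : ℝ), abs_sub_comm (r : ℝ)]
    linarith [abs_nonneg (1 - (s : ℝ)), abs_nonneg (1 - (r : ℝ))]
  · have h := dist_triangle (X.S (bottom r)) (X.S (bottom 0)) (X.S (left s))
    rw [X.sq1_bottom, ← c1, X.sq1_left] at h
    refine h.trans ?_
    have := r.2.1; have := s.2.1
    simp [taxi, left, bottom]
    rw [abs_of_nonneg, abs_of_nonneg] <;> linarith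
  · have h := dist_triangle (X.S (bottom r)) (X.S (bottom 1)) (X.S (right s))
    rw [X.sq1_bottom, ← c3, X.sq1_right] at h
    refine h.trans ?_
    have := r.2.1; have := s.2.1
    simp [taxi, right, bottom, abs_sub_comm (r : ℝ)]
    rw [abs_of_nonneg (a := (s : ℝ))] <;> linarith [abs_nonneg (1 - (r : ℝ))]
  · rw [X.sq1_bottom]; simp [taxi, bottom, abs_sub_comm (s : ℝ)]
    linarith [abs_nonneg ((r : ℝ) - s)]
  · refine (htwo _ _).trans ?_; simp [taxi, bottom, top]
  · have h := dist_triangle (X.S (top r)) (X.S (top 0)) (X.S (left s))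
    rw [X.sq1_top, ← c2, X.sq1_left] at h
    refine h.trans ?_
    have := r.2.1; have := s.2.1
    simp [taxi, left, top, abs_sub_comm (s : ℝ)]
    rw [abs_of_nonneg (a := (r : ℝ))] <;> linarith [abs_nonneg (1 - (s : ℝ))]
  · have h := dist_triangle (X.S (top r)) (X.S (top 1)) (X.S (right s))
    rw [X.sq1_top, ← c4, X.sq1_right] at h
    refine h.trans ?_
    simp [taxi, right, top, abs_sub_comm (s : ℝ), abs_sub_comm (r : ℝ)]
    linarith [abs_nonneg (1 - (s : ℝ)), abs_nonneg (1 - (r : ℝ))]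
  · refine (htwo _ _).trans ?_; simp [taxi, bottom, top]
  · rw [X.sq1_top]; simp [taxi, top, abs_sub_comm (s : ℝ)]
    linarith [abs_nonneg ((r : ℝ) - s)]

/-- A taxicab-short function on the unit square, transported along the boundary of one copy,
extends to this copy. -/
theorem exists_extension (X : SquaMS) {F : ℝ × ℝ → ℝ}
    (hF : ∀ p ∈ unitSquare, ∀ q ∈ unitSquare, |F p - F q| ≤ taxi p q)
    (hF2 : ∀ p ∈ unitSquare, F p ∈ Set.Icc (0 : ℝ) 2) (m : Idx) :
    ∃ g : X.carrier → ℝ, (∀ x y, |g x - g y| ≤ dist x y / 3) ∧ (∀ x, g x ∈ Set.Icc (0 : ℝ) 2) ∧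
      ∀ z : M0, g (X.S z) = F (contract m z) := by
  have : Nonempty M0 := ⟨left 0⟩
  have hmem : ∀ z : M0, contract m z ∈ unitSquare :=
    fun z => contract_mem m (boundary_subset z.2)
  have hinv : ∀ z, Function.invFun X.S (X.S z) = z := Function.leftInverse_invFun X.S_injective
  have hL : LipschitzOnWith (1 / 3 : ℝ≥0)
      (fun x : X.carrier => F (contract m (Function.invFun X.S x : M0))) (Set.range X.S) := by
    refine LipschitzOnWith.of_dist_le_mul ?_
    rintro _ ⟨z, rfl⟩ _ ⟨w, rfl⟩
    simp only [hinv]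
    rw [Real.dist_eq]
    refine (hF _ (hmem z) _ (hmem w)).trans ?_
    rw [taxi_contract]
    push_cast
    linarith [X.sq2 z w]
  obtain ⟨g, hg, hgeq⟩ := hL.extend_real
  refine ⟨fun x => max 0 (min (g x) 2), fun x y => ?_, fun x => ⟨le_max_left _ _, ?_⟩, fun z => ?_⟩
  · have h := ((hg.min_const 2).const_max 0).dist_le_mul x y
    rw [Real.dist_eq] at h
    push_cast at h
    linarith
  · exact max_le (by norm_num) (min_le_right _ _)
  · have h := hgeq ⟨z, rfl⟩
    simp only [hinv] at h
    have h2 := hF2 _ (hmem z)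
    simp only
    rw [← h, min_eq_left h2.2, max_eq_right h2.1]

/-- Lower bounds of the path distance: a short function on the unit square and a compatible function
on one copy of `X` combine to a short function on `M ⊗ X`. -/
theorem exists_short (X : SquaMS) {F : ℝ × ℝ → ℝ}
    (hF : ∀ p ∈ unitSquare, ∀ q ∈ unitSquare, |F p - F q| ≤ taxi p q)
    (hF2 : ∀ p ∈ unitSquare, F p ∈ Set.Icc (0 : ℝ) 2) (m₀ : Idx) {g : X.carrier → ℝ}
    (hg : ∀ x y, |g x - g y| ≤ dist x y / 3) (hg2 : ∀ x, g x ∈ Set.Icc (0 : ℝ) 2)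
    (hgF : ∀ z : M0, g (X.S z) = F (contract m₀ z)) :
    ∃ f : Idx → X.carrier → ℝ, (∀ m x n y, |f m x - f n y| ≤ X.pathDist (m, x) (n, y)) ∧
      (∀ m (z : M0), f m (X.S z) = F (contract m z)) ∧ ∀ x, f m₀ x = g x := by
  classical
  choose e he he2 heF using X.exists_extension hF hF2
  have key : ∃ f : Idx → X.carrier → ℝ, (∀ x, f m₀ x = g x) ∧
      (∀ m x y, |f m x - f m y| ≤ dist x y / 3) ∧ (∀ m x, f m x ∈ Set.Icc (0 : ℝ) 2) ∧
      ∀ m (z : M0), f m (X.S z) = F (contract m z) := by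
    refine ⟨fun m => if m = m₀ then g else e m, fun x => by simp, fun m x y => ?_, fun m x => ?_,
      fun m z => ?_⟩ <;> by_cases h : m = m₀ <;> simp only [h, if_true, if_false]
    · exact hg x y
    · exact he m x y
    · exact hg2 x
    · exact he2 m x
    · exact hgF z
    · exact heF m z
  obtain ⟨f, hf0, hf1, hf2, hf3⟩ := key
  refine ⟨f, fun m x n y => ?_, hf3, hf0⟩
  let f' : X.Tensor → ℝ := Quotient.lift (fun p : Idx × X.carrier => f p.1 p.2) (by
    intro p q h
    rcases X.glueSetoid_iff.1 h with h | ⟨z, w, h1, h2, h3⟩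
    · rw [h]
    · rw [h1, h2, hf3, hf3, h3])
  have h := X.le_pathDist f' (fun m x y => by rw [Real.dist_eq]; exact hf1 m x y)
    (fun a b => by
      induction a using Quotient.inductionOn with | h p => ?_
      induction b using Quotient.inductionOn with | h q => ?_
      rw [Real.dist_eq]
      have h1 := hf2 p.1 p.2
      have h2 := hf2 q.1 q.2
      change |f p.1 p.2 - f q.1 q.2| ≤ 2
      exact abs_le.2 ⟨by linarith [h1.1, h2.2], by linarith [h1.2, h2.1]⟩) (m, x) (n, y)
  rw [Real.dist_eq] at h
  exact h

theorem taxi_le_pathDist (X : SquaMS) (m n : Idx) (z w : M0) :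
    taxi (contract m z) (contract n w) ≤ X.pathDist (m, X.S z) (n, X.S w) := by
  have hw := contract_mem n (boundary_subset w.2)
  have hF : ∀ p ∈ unitSquare, ∀ q ∈ unitSquare,
      |taxi p (contract n w) - taxi q (contract n w)| ≤ taxi p q := by
    intro p _ q _
    rw [abs_le]
    constructor
    · linarith [taxi_triangle q p (contract n w), taxi_comm p q]
    · linarith [taxi_triangle p q (contract n w)]
  have hF2 : ∀ p ∈ unitSquare, taxi p (contract n w) ∈ Set.Icc (0 : ℝ) 2 :=
    fun p hp => ⟨taxi_nonneg _ _, taxi_le_two hp hw⟩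
  obtain ⟨g, hg, hg2, hgF⟩ := X.exists_extension hF hF2 m
  obtain ⟨f, hf, hfF, -⟩ := X.exists_short hF hF2 m hg hg2 hgF
  have h := hf m (X.S z) n (X.S w)
  rw [hfF, hfF] at h
  have h0 : taxi (contract n w) (contract n w) = 0 := by simp [taxi]
  rw [h0, sub_zero, abs_of_nonneg (taxi_nonneg _ _)] at h
  exact h

/-- Within one copy of `X`, the path distance is bounded below by a multiple of the distance. -/
theorem dist_le_pathDist (X : SquaMS) (m : Idx) (x y : X.carrier) :
    dist x y / 6 ≤ X.pathDist (m, x) (m, y) := by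
  have : Nonempty M0 := ⟨left 0⟩
  let G : ℝ × ℝ → ℝ := fun p => ⨅ z : M0, (dist x (X.S z) / 6 + taxi p (contract m z))
  have hnn : ∀ (p : ℝ × ℝ) (z : M0), 0 ≤ dist x (X.S z) / 6 + taxi p (contract m z) := fun p z =>
    add_nonneg (by have : 0 ≤ dist x (X.S z) := dist_nonneg
                   linarith) (taxi_nonneg _ _)
  have hbdd : ∀ p : ℝ × ℝ, BddBelow (Set.range fun z : M0 =>
      (dist x (X.S z) / 6 + taxi p (contract m z))) := by
    intro p
    refine ⟨0, ?_⟩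
    rintro _ ⟨z, rfl⟩
    exact hnn p z
  have hG : ∀ p q, G p ≤ G q + taxi p q := by
    intro p q
    rw [← sub_le_iff_le_add]
    refine le_ciInf fun z => ?_
    have h1 : G p ≤ _ := ciInf_le (hbdd p) z
    have h2 := taxi_triangle p q (contract m z)
    linarith
  have hG0 : ∀ p, 0 ≤ G p := fun p => le_ciInf fun z => hnn p z
  have hGS : ∀ z : M0, G (contract m z) = dist x (X.S z) / 6 := by
    intro z
    refine le_antisymm ?_ (le_ciInf fun w => ?_)
    · refine (ciInf_le (hbdd _) z).trans (le_of_eq ?_)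
      simp [taxi]
    · rw [taxi_contract]
      have h1 := dist_triangle x (X.S w) (X.S z)
      have h2 := X.dist_S_le w z
      rw [taxi_comm] at h2
      linarith
  have hgL : ∀ a b, |dist x a / 6 - dist x b / 6| ≤ dist a b / 3 := by
    intro a b
    have h1 := dist_triangle x a b
    have h2 := dist_triangle x b a
    rw [dist_comm b a] at h2
    have h3 : 0 ≤ dist a b := dist_nonneg
    rw [abs_le]
    constructor <;> linarith
  have hg2 : ∀ a, dist x a / 6 ∈ Set.Icc (0 : ℝ) 2 := by
    intro a
    have h1 : 0 ≤ dist x a := dist_nonneg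
    have h2 := X.dist_le_two x a
    constructor <;> linarith
  have hFL : ∀ p ∈ unitSquare, ∀ q ∈ unitSquare, |min (G p) 2 - min (G q) 2| ≤ taxi p q := by
    intro p _ q _
    have h1 := abs_min_sub_min_le_max (G p) 2 (G q) 2
    have h2 : |G p - G q| ≤ taxi p q := by
      rw [abs_le]
      constructor <;> linarith [hG p q, hG q p, taxi_comm p q]
    refine h1.trans (max_le h2 ?_)
    simpa using taxi_nonneg p q
  have hF2 : ∀ p ∈ unitSquare, min (G p) 2 ∈ Set.Icc (0 : ℝ) 2 :=
    fun p _ => ⟨le_min (hG0 p) (by norm_num), min_le_right _ _⟩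
  obtain ⟨f, hf, -, hf0⟩ := X.exists_short hFL hF2 m hgL hg2 (fun z => by
    rw [hGS, min_eq_left (hg2 _).2])
  have h := hf m x m y
  rw [hf0, hf0, dist_self, zero_div, zero_sub, abs_neg, abs_of_nonneg (hg2 y).1] at h
  exact h

theorem continuous_S (X : SquaMS) : Continuous X.S := by
  have : LipschitzWith 4 X.S := by
    refine LipschitzWith.of_dist_le_mul fun z w => (X.dist_S_le z w).trans ?_
    have h1 : |z.1.1 - w.1.1| ≤ dist z w := le_max_left _ _
    have h2 : |z.1.2 - w.1.2| ≤ dist z w := le_max_right _ _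
    push_cast
    simp only [taxi]
    linarith
  exact this.continuous

theorem isClosed_boundary : IsClosed boundary := by
  have h : boundary = ((({0, 1} : Set ℝ) ×ˢ Set.Icc (0 : ℝ) 1) ∪
      (Set.Icc (0 : ℝ) 1 ×ˢ ({0, 1} : Set ℝ))) := by
    ext p
    simp [boundary, Set.mem_prod]
  rw [h]
  have h01 : IsClosed ({0, 1} : Set ℝ) := (Set.toFinite _).isClosed
  exact (h01.prod isClosed_Icc).union (isClosed_Icc.prod h01)

theorem isCompact_unitSquare : IsCompact unitSquare := by
  have h : unitSquare = Set.Icc (0 : ℝ) 1 ×ˢ Set.Icc (0 : ℝ) 1 := rfl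
  rw [h]
  exact isCompact_Icc.prod isCompact_Icc

theorem isClosed_range_S (X : SquaMS) : IsClosed (Set.range X.S) := by
  have : CompactSpace M0 :=
    isCompact_iff_compactSpace.1 (isCompact_unitSquare.of_isClosed_subset isClosed_boundary
      boundary_subset)
  exact (isCompact_range X.continuous_S).isClosed

theorem eq_of_pathDist_eq_zero_aux (X : SquaMS) {m n : Idx} {x y : X.carrier} (hmn : m ≠ n)
    (hx : x ∉ Set.range X.S) : X.pathDist (m, x) (n, y) ≠ 0 := by
  classical
  have hpos : 0 < Metric.infDist x (Set.range X.S) :=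
    (X.isClosed_range_S.notMem_iff_infDist_pos ⟨X.S (left 0), left 0, rfl⟩).1 hx
  set δ := Metric.infDist x (Set.range X.S) with hδ
  have hδ2 : δ ≤ 2 := (Metric.infDist_le_dist_of_mem (Set.mem_range_self (left 0))).trans (X.dist_le_two _ _)
  let b : X.carrier → ℝ := fun a => max 0 ((δ - dist x a) / 3)
  have hb0 : ∀ z, b (X.S z) = 0 := by
    intro z
    have : δ ≤ dist x (X.S z) := Metric.infDist_le_dist_of_mem ⟨z, rfl⟩
    exact max_eq_left (by linarith)
  have hbL : ∀ a c, |b a - b c| ≤ dist a c / 3 := by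
    intro a c
    refine (abs_max_sub_max_le_max _ _ _ _).trans ?_
    have h1 := dist_triangle x a c
    have h2 := dist_triangle x c a
    rw [dist_comm c a] at h2
    have h3 : 0 ≤ dist a c := dist_nonneg
    refine max_le (by simpa using div_nonneg h3 (by norm_num : (0 : ℝ) ≤ 3)) ?_
    rw [abs_le]
    constructor <;> linarith
  have hb2 : ∀ a, b a ∈ Set.Icc (0 : ℝ) 2 := fun a =>
    ⟨le_max_left _ _, max_le (by norm_num) (by have : 0 ≤ dist x a := dist_nonneg
                                               linarith)⟩
  let f : X.Tensor → ℝ := Quotient.lift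
    (fun p : Idx × X.carrier => if p.1 = m then b p.2 else 0) (by
    intro p q h
    rcases X.glueSetoid_iff.1 h with h | ⟨z, w, h1, h2, h3⟩
    · rw [h]
    · simp [h1, h2, hb0])
  have hf : ∀ k a, f (X.tmk k a) = if k = m then b a else 0 := fun k a => rfl
  have h := X.le_pathDist f (fun k a c => by
      rw [Real.dist_eq, hf, hf]
      split_ifs
      · exact hbL a c
      · simpa using div_nonneg (dist_nonneg : 0 ≤ dist a c) (by norm_num : (0 : ℝ) ≤ 3))
    (fun a c => by
      have hf2 : ∀ a, f a ∈ Set.Icc (0 : ℝ) 2 := by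
        intro a
        induction a using Quotient.inductionOn with | h p => ?_
        change (if p.1 = m then b p.2 else 0) ∈ Set.Icc (0 : ℝ) 2
        split_ifs
        · exact hb2 _
        · simp
      rw [Real.dist_eq, abs_le]
      constructor <;> linarith [(hf2 a).1, (hf2 a).2, (hf2 c).1, (hf2 c).2]) (m, x) (n, y)
  simp only [hf, if_true, hmn.symm, if_false, Real.dist_eq, sub_zero] at h
  have hbx : b x = δ / 3 := by
    simp only [b, dist_self, sub_zero]
    exact max_eq_right (by linarith)
  rw [hbx, abs_of_pos (by linarith)] at h
  linarith

theorem rel_of_pathDist_eq_zero (X : SquaMS) {p q : Idx × X.carrier} (h : X.pathDist p q = 0) :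
    X.glueSetoid.r p q := by
  obtain ⟨m, x⟩ := p
  obtain ⟨n, y⟩ := q
  by_cases hmn : m = n
  · subst hmn
    have h1 := X.dist_le_pathDist m x y
    rw [h] at h1
    have h2 : dist x y = 0 := le_antisymm (by linarith) dist_nonneg
    rw [dist_eq_zero.1 h2]
  · by_cases hx : x ∈ Set.range X.S
    · by_cases hy : y ∈ Set.range X.S
      · obtain ⟨z, rfl⟩ := hx
        obtain ⟨w, rfl⟩ := hy
        have h1 := X.taxi_le_pathDist m n z w
        rw [h] at h1
        exact X.glueSetoid_iff.2 (Or.inr ⟨z, w, rfl, rfl,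
          eq_of_taxi_eq_zero (le_antisymm h1 (taxi_nonneg _ _))⟩)
      · rw [X.pathDist_comm] at h
        exact absurd h (X.eq_of_pathDist_eq_zero_aux (Ne.symm hmn) hy)
    · exact absurd h (X.eq_of_pathDist_eq_zero_aux hmn hx)

/-- The metric of `M ⊗ X`: the distance of `m ⊗ x` and `n ⊗ y` is the infimum of the scores of all
finite paths in `M × X` from `(m, x)` to `(n, y)`. -/
instance tensorMetric (X : SquaMS) : MetricSpace X.tensorObj.carrier where
  dist := Quotient.lift₂ (fun p q => X.pathDist p q)
    (fun _ _ _ _ h1 h2 => X.pathDist_congr h1 h2)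
  dist_self a := by
    induction a using Quotient.inductionOn with | h p => exact X.pathDist_self p
  dist_comm a b := by
    induction a using Quotient.inductionOn with | h p => ?_
    induction b using Quotient.inductionOn with | h q => exact X.pathDist_comm p q
  dist_triangle a b c := by
    induction a using Quotient.inductionOn with | h p => ?_
    induction b using Quotient.inductionOn with | h q => ?_
    induction c using Quotient.inductionOn with | h r => exact X.pathDist_triangle p q r
  eq_of_dist_eq_zero {a b} h := by
    induction a using Quotient.inductionOn with | h p => ?_
    induction b using Quotient.inductionOn with | h q => ?_
    exact Quotient.sound (X.rel_of_pathDist_eq_zero h)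

theorem tensor_dist_eq (X : SquaMS) (m n : Idx) (x y : X.carrier) :
    dist (α := X.tensorObj.carrier) (X.tmk m x) (X.tmk n y) = X.pathDist (m, x) (n, y) := rfl

/-- A path in a metric space which is short on each third of the unit interval is short. -/
theorem dist_le_of_thirds {Y : Type} [PseudoMetricSpace Y] {φ : unitInterval → Y}
    (h : ∀ (k : Fin 3) (r s r' s' : unitInterval), (r : ℝ) = (k : ℕ) / 3 + (r' : ℝ) / 3 →
      (s : ℝ) = (k : ℕ) / 3 + (s' : ℝ) / 3 → dist (φ r) (φ s) ≤ |(s' : ℝ) - r'| / 3)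
    (r s : unitInterval) : dist (φ r) (φ s) ≤ |(s : ℝ) - r| := by
  have hk : ∀ (k : Fin 3) (r s : unitInterval), ((k : ℕ) : ℝ) / 3 ≤ r → r ≤ s →
      (s : ℝ) ≤ (k : ℕ) / 3 + 1 / 3 → dist (φ r) (φ s) ≤ (s : ℝ) - r := by
    intro k r s h1 h2 h3
    have h2' : (r : ℝ) ≤ s := h2
    have h4 := h k r s ⟨3 * r - (k : ℕ), by constructor <;> linarith⟩
      ⟨3 * s - (k : ℕ), by constructor <;> linarith⟩ (by simp only; ring) (by simp only; ring)
    simp only at h4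
    rw [abs_of_nonneg (by linarith)] at h4
    linarith
  have h0 : ∀ r s : unitInterval, (0 : ℝ) ≤ r → r ≤ s → (s : ℝ) ≤ 1 / 3 →
      dist (φ r) (φ s) ≤ (s : ℝ) - r :=
    fun r s a b c => hk 0 r s (by simpa using a) b (by simpa using c)
  have h1 : ∀ r s : unitInterval, (1 / 3 : ℝ) ≤ r → r ≤ s → (s : ℝ) ≤ 2 / 3 →
      dist (φ r) (φ s) ≤ (s : ℝ) - r :=
    fun r s a b c => hk 1 r s (by norm_num at a ⊢; exact a) b (by norm_num at c ⊢; exact c)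
  have h2 : ∀ r s : unitInterval, (2 / 3 : ℝ) ≤ r → r ≤ s → (s : ℝ) ≤ 1 →
      dist (φ r) (φ s) ≤ (s : ℝ) - r :=
    fun r s a b c => hk 2 r s (by norm_num at a ⊢; exact a) b (by norm_num at c ⊢; exact c)
  have main : ∀ r s : unitInterval, r ≤ s → dist (φ r) (φ s) ≤ (s : ℝ) - r := by
    let a : unitInterval := ⟨1 / 3, by constructor <;> norm_num⟩
    let b : unitInterval := ⟨2 / 3, by constructor <;> norm_num⟩
    have ha : (a : ℝ) = 1 / 3 := rfl
    have hb : (b : ℝ) = 2 / 3 := rfl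
    have step2 : ∀ r s : unitInterval, (1 : ℝ) / 3 ≤ r → r ≤ s →
        dist (φ r) (φ s) ≤ (s : ℝ) - r := by
      intro r s hr hrs
      have hrs' : (r : ℝ) ≤ s := hrs
      have := s.2.2
      rcases le_total (s : ℝ) (2 / 3) with hs | hs
      · exact h1 r s (by linarith) hrs (by linarith)
      · rcases le_total (r : ℝ) (2 / 3) with hr' | hr'
        · have e1 := h1 r b (by linarith) hr' hb.le
          have e2 := h2 b s hb.ge hs (by linarith)
          linarith [dist_triangle (φ r) (φ b) (φ s)]
        · exact h2 r s (by linarith) hrs (by linarith)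
    intro r s hrs
    have hrs' : (r : ℝ) ≤ s := hrs
    have := r.2.1
    rcases le_total (s : ℝ) (1 / 3) with hs | hs
    · exact h0 r s (by linarith) hrs (by linarith)
    · rcases le_total (r : ℝ) (1 / 3) with hr' | hr'
      · have e1 := h0 r a (by linarith) hr' ha.le
        have e2 := step2 a s ha.ge hs
        linarith [dist_triangle (φ r) (φ a) (φ s)]
      · exact step2 r s hr' hrs
  rcases le_total r s with hrs | hrs
  · have hrs' : (r : ℝ) ≤ s := hrs
    rw [abs_of_nonneg (by linarith)]
    exact main r s hrs
  · have hrs' : (s : ℝ) ≤ r := hrs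
    rw [dist_comm, abs_sub_comm, abs_of_nonneg (by linarith)]
    exact main s r hrs

theorem tensor_sq2 (X : SquaMS) (z w : M0) :
    taxi z w ≤ dist (X.tensorObj.S z) (X.tensorObj.S w) := by
  have h := X.taxi_le_pathDist (idxOf z) (idxOf w) (localOf z) (localOf w)
  rw [contract_localOf, contract_localOf] at h
  exact h

theorem tensor_sq1 (X : SquaMS) (side : unitInterval → M0) (cell : Fin 3 → Idx)
    (htaxi : ∀ r s, taxi (side r) (side s) = |(s : ℝ) - r|)
    (hX : ∀ r s, dist (X.S (side r)) (X.S (side s)) = |(s : ℝ) - r|)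
    (hcell : ∀ (k : Fin 3) (r r' : unitInterval), (r : ℝ) = (k : ℕ) / 3 + (r' : ℝ) / 3 →
      contract (cell k) (side r') = side r) (r s : unitInterval) :
    dist (X.tensorObj.S (side r)) (X.tensorObj.S (side s)) = |(s : ℝ) - r| := by
  refine le_antisymm ?_ ((htaxi r s).symm.le.trans (X.tensor_sq2 _ _))
  refine dist_le_of_thirds (φ := fun r => X.tensorObj.S (side r)) (fun k r s r' s' hr hs => ?_) r s
  have e1 : X.tensorObj.S (side r) = X.tmk (cell k) (X.S (side r')) :=
    X.tensorS_eq (hcell k r r' hr)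
  have e2 : X.tensorObj.S (side s) = X.tmk (cell k) (X.S (side s')) :=
    X.tensorS_eq (hcell k s s' hs)
  simp only [e1, e2]
  refine (X.pathDist_same_le _ _ _).trans (le_of_eq ?_)
  rw [hX]

/-- The square metric space `M ⊗ X`. -/
def tensorObj (X : SquaMS) : SquaMS where
  toSquaSet := X.toSquaSet.tensorObj
  metric := X.tensorMetric
  dist_le_two a b := by
    induction a using Quotient.inductionOn with | h p => ?_
    induction b using Quotient.inductionOn with | h q => exact X.pathDist_le_two p q
  sq1_left := X.tensor_sq1 left (fun k => ⟨(0, k), by simp⟩)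
    (fun r s => by simp [taxi, left, abs_sub_comm]) X.sq1_left
    (fun k r r' h => by simp [contract, left, h])
  sq1_right := X.tensor_sq1 right (fun k => ⟨(2, k), by simp⟩)
    (fun r s => by simp [taxi, right, abs_sub_comm]) X.sq1_right
    (fun k r r' h => by simp [contract, right, h]; norm_num)
  sq1_bottom := X.tensor_sq1 bottom (fun k => ⟨(k, 0), by simp⟩)
    (fun r s => by simp [taxi, bottom, abs_sub_comm]) X.sq1_bottom
    (fun k r r' h => by simp [contract, bottom, h])
  sq1_top := X.tensor_sq1 top (fun k => ⟨(k, 2), by simp⟩)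
    (fun r s => by simp [taxi, top, abs_sub_comm]) X.sq1_top
    (fun k r r' h => by simp [contract, top, h]; norm_num)
  sq2 := X.tensor_sq2

/-- A map on `M ⊗ X` which contracts distances in each copy by `3` is short. -/
theorem tensor_short (X : SquaMS) {Z : Type} [PseudoMetricSpace Z] (f : X.tensorObj.carrier → Z)
    (hsame : ∀ m x y, dist (f (X.tmk m x)) (f (X.tmk m y)) ≤ dist x y / 3)
    (htwo : ∀ a b, dist (f a) (f b) ≤ 2) (a b : X.tensorObj.carrier) :
    dist (f a) (f b) ≤ dist a b := by
  induction a using Quotient.inductionOn with | h p => ?_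
  induction b using Quotient.inductionOn with | h q => ?_
  exact X.le_pathDist f hsame htwo p q

/-- The map `M ⊗ f` on square metric spaces. -/
def tensorMap {X Y : SquaMS} (f : X ⟶ Y) : X.tensorObj ⟶ Y.tensorObj where
  toHom := SquaSet.tensorMap f.toHom
  short := X.tensor_short (Z := Y.tensorObj.carrier) _
    (fun m x y => (Y.pathDist_same_le m (f.toFun x) (f.toFun y)).trans
      (div_le_div_of_nonneg_right (f.short x y) (by norm_num)))
    (fun a b => Y.tensorObj.dist_le_two _ _)

/-- The endofunctor `M ⊗ -` on square metric spaces. -/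
def tensor : SquaMS ⥤ SquaMS where
  obj := tensorObj
  map := tensorMap
  map_id X := by
    ext x
    induction x using Quotient.inductionOn with | h p => rfl
  map_comp f g := by
    ext x
    induction x using Quotient.inductionOn with | h p => rfl

end SquaMS

/-! ## The Sierpinski carpet as a coalgebra on square sets -/

/-- The action `σ(A) = ⋃_m σ_m(A)` on sets. -/
def hutchinson (A : Set (ℝ × ℝ)) : Set (ℝ × ℝ) := ⋃ m, contract m '' A

theorem hutchinson_mono {A B : Set (ℝ × ℝ)} (h : A ⊆ B) : hutchinson A ⊆ hutchinson B :=
  Set.iUnion_mono fun _ => Set.image_mono h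

theorem continuous_contract (m : Idx) : Continuous (contract m) := by
  unfold contract
  fun_prop

theorem dist_contract (m : Idx) (p q : ℝ × ℝ) :
    dist (contract m p) (contract m q) ≤ dist p q / 3 := by
  have h : ∀ a b c : ℝ, dist (a / 3 + b / 3) (a / 3 + c / 3) = dist b c / 3 := by
    intro a b c
    rw [Real.dist_eq, Real.dist_eq, show a / 3 + b / 3 - (a / 3 + c / 3) = (b - c) / 3 by ring,
      abs_div]
    norm_num
  simp only [Prod.dist_eq, contract, h]
  exact max_le (div_le_div_of_nonneg_right (le_max_left _ _) (by norm_num))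
    (div_le_div_of_nonneg_right (le_max_right _ _) (by norm_num))

theorem subset_of_hutchinson {A K : Set (ℝ × ℝ)} (hA : A ⊆ unitSquare) (hAσ : A ⊆ hutchinson A)
    (hK : K ⊆ unitSquare) (hne : K.Nonempty) (hc : IsClosed K) (hKσ : hutchinson K ⊆ K) :
    A ⊆ K := by
  have key : ∀ n : ℕ, ∀ p ∈ A, ∃ q ∈ K, dist p q ≤ (1 / 3 : ℝ) ^ n := by
    intro n
    induction n with
    | zero =>
      intro p hp
      obtain ⟨q, hq⟩ := hne
      refine ⟨q, hq, ?_⟩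
      obtain ⟨⟨_, _⟩, _, _⟩ := hA hp
      obtain ⟨⟨_, _⟩, _, _⟩ := hK hq
      rw [pow_zero, Prod.dist_eq, Real.dist_eq, Real.dist_eq]
      exact max_le (abs_le.2 ⟨by linarith, by linarith⟩) (abs_le.2 ⟨by linarith, by linarith⟩)
    | succ n ih =>
      intro p hp
      obtain ⟨m, p', hp', rfl⟩ := Set.mem_iUnion.1 (hAσ hp)
      obtain ⟨q, hq, hd⟩ := ih p' hp'
      refine ⟨contract m q, hKσ (Set.mem_iUnion.2 ⟨m, q, hq, rfl⟩), ?_⟩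
      refine (dist_contract m p' q).trans ?_
      rw [pow_succ]
      linarith
  intro p hp
  rw [← hc.closure_eq, Metric.mem_closure_iff]
  intro ε hε
  obtain ⟨n, hn⟩ := exists_pow_lt_of_lt_one hε (by norm_num : (1 / 3 : ℝ) < 1)
  obtain ⟨q, hq, hd⟩ := key n p hp
  exact ⟨q, hq, hd.trans_lt hn⟩

theorem boundary_subset_hutchinson : boundary ⊆ hutchinson boundary := fun z hz =>
  Set.mem_iUnion.2 ⟨idxOf ⟨z, hz⟩, localOf ⟨z, hz⟩, (localOf ⟨z, hz⟩).2, contract_localOf ⟨z, hz⟩⟩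

/-- There is exactly one non-empty compact subset of the unit square which is fixed by `σ`. -/
theorem existsUnique_carpet :
    ∃! K : Set (ℝ × ℝ), K.Nonempty ∧ IsCompact K ∧ K ⊆ unitSquare ∧ hutchinson K = K := by
  let L : Set (ℝ × ℝ) := ⋃₀ {A | A ⊆ unitSquare ∧ A ⊆ hutchinson A}
  have hLU : L ⊆ unitSquare := Set.sUnion_subset fun A hA => hA.1
  have hLσ : L ⊆ hutchinson L := Set.sUnion_subset fun A hA =>
    hA.2.trans (hutchinson_mono (Set.subset_sUnion_of_mem hA))
  have hσU : ∀ A ⊆ unitSquare, hutchinson A ⊆ unitSquare := by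
    intro A hA
    refine Set.iUnion_subset fun m => ?_
    rintro _ ⟨p, hp, rfl⟩
    exact contract_mem m (hA hp)
  have hmax : ∀ A ⊆ unitSquare, A ⊆ hutchinson A → A ⊆ L := fun A h1 h2 =>
    Set.subset_sUnion_of_mem ⟨h1, h2⟩
  have hσL : hutchinson L ⊆ L := hmax _ (hσU L hLU) (hutchinson_mono hLσ)
  have hUc : IsClosed unitSquare := SquaMS.isCompact_unitSquare.isClosed
  have hclU : closure L ⊆ unitSquare := closure_minimal hLU hUc
  have hclc : IsCompact (closure L) :=
    SquaMS.isCompact_unitSquare.of_isClosed_subset isClosed_closure hclU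
  have hclσ : closure L ⊆ hutchinson (closure L) := by
    refine closure_minimal (hLσ.trans (hutchinson_mono subset_closure)) ?_
    exact (isCompact_iUnion fun m => hclc.image (continuous_contract m)).isClosed
  have hLcl : closure L = L := Set.Subset.antisymm (hmax _ hclU hclσ) subset_closure
  have hbL : boundary ⊆ L := hmax _ boundary_subset boundary_subset_hutchinson
  have hLc : IsCompact L := hLcl ▸ hclc
  have hLne : L.Nonempty := ⟨left 0, hbL (left 0).2⟩
  refine ⟨L, ⟨hLne, hLc, hLU, Set.Subset.antisymm hσL hLσ⟩, ?_⟩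
  rintro K ⟨hne, hK, hKU, hKσ⟩
  refine Set.Subset.antisymm (hmax _ hKU hKσ.ge) ?_
  exact subset_of_hutchinson hLU hLσ hKU hne hK.isClosed hKσ.le

/-- The Sierpinski carpet `𝕊`: the unique non-empty compact subset of the unit square which is fixed
by `σ`. -/
def carpet : Set (ℝ × ℝ) := Classical.choose existsUnique_carpet.exists

theorem carpet_spec :
    carpet.Nonempty ∧ IsCompact carpet ∧ carpet ⊆ unitSquare ∧ hutchinson carpet = carpet :=
  Classical.choose_spec existsUnique_carpet.exists

theorem boundary_subset_carpet : boundary ⊆ carpet :=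
  subset_of_hutchinson boundary_subset boundary_subset_hutchinson carpet_spec.2.2.1 carpet_spec.1
    carpet_spec.2.1.isClosed carpet_spec.2.2.2.le

theorem contract_mem_carpet (m : Idx) {p : ℝ × ℝ} (hp : p ∈ carpet) : contract m p ∈ carpet :=
  carpet_spec.2.2.2.le (Set.mem_iUnion.2 ⟨m, p, hp, rfl⟩)

/-- The carpet as a square set, with the inclusion of `M₀`. -/
def carpetObj : SquaSet where
  carrier := carpet
  S z := ⟨z, boundary_subset_carpet z.2⟩
  S_injective _ _ h := Subtype.ext (congrArg (fun a : carpet => a.1) h)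

/-- The map `τ : M ⊗ 𝕊 → 𝕊`, `m ⊗ s ↦ σ_m(s)`. -/
def tau : SquaSet.tensor.obj carpetObj ⟶ carpetObj where
  toFun := Quotient.lift
    (fun p : Idx × carpetObj.carrier => (⟨contract p.1 p.2.1, contract_mem_carpet p.1 p.2.2⟩ :
      carpetObj.carrier)) (by
    rintro ⟨m, x⟩ ⟨n, y⟩ h
    rcases carpetObj.glueSetoid_iff.1 h with h | ⟨z, w, h1, h2, h3⟩
    · rw [h]
    · simp only at h1 h2
      subst h1 h2
      exact Subtype.ext h3)
  map_S z := Subtype.ext (contract_localOf z)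

theorem tau_bijective : Function.Bijective tau.toFun := by
  constructor
  · intro a b h
    induction a using Quotient.inductionOn with | h p => ?_
    induction b using Quotient.inductionOn with | h q => ?_
    obtain ⟨⟨⟨i, j⟩, hm⟩, ⟨⟨x, y⟩, hp⟩⟩ := p
    obtain ⟨⟨⟨k, l⟩, hn⟩, ⟨⟨t, u⟩, hq⟩⟩ := q
    have h' : contract ⟨(i, j), hm⟩ (x, y) = contract ⟨(k, l), hn⟩ (t, u) :=
      congrArg Subtype.val h
    have hpU := carpet_spec.2.2.1 hp
    have hqU := carpet_spec.2.2.1 hq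
    have h'' := h'
    simp only [contract, Prod.mk.injEq] at h''
    refine (carpetObj.tmk_eq_iff (m := ⟨(i, j), hm⟩) (n := ⟨(k, l), hn⟩) (x := ⟨(x, y), hp⟩)
      (y := ⟨(t, u), hq⟩)).2 ?_
    have glue := fun (h1 : (x, y) ∈ boundary) (h2 : (t, u) ∈ boundary) =>
      (⟨⟨(x, y), h1⟩, ⟨(t, u), h2⟩, rfl, rfl, h'⟩ : ∃ z w : M0,
        (⟨(x, y), hp⟩ : carpet) = carpetObj.S z ∧ (⟨(t, u), hq⟩ : carpet) = carpetObj.S w ∧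
          contract ⟨(i, j), hm⟩ z = contract ⟨(k, l), hn⟩ w)
    rcases coord_cases hpU.1 hqU.1 h''.1 with ⟨rfl, rfl⟩ | ⟨-, rfl, rfl⟩ | ⟨-, rfl, rfl⟩
    · rcases coord_cases hpU.2 hqU.2 h''.2 with ⟨rfl, rfl⟩ | ⟨-, rfl, rfl⟩ | ⟨-, rfl, rfl⟩
      · exact Or.inl ⟨rfl, rfl⟩
      · exact Or.inr (glue (Or.inr ⟨hpU.1, Or.inr rfl⟩) (Or.inr ⟨hpU.1, Or.inl rfl⟩))
      · exact Or.inr (glue (Or.inr ⟨hpU.1, Or.inl rfl⟩) (Or.inr ⟨hpU.1, Or.inr rfl⟩))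
    · exact Or.inr (glue (Or.inl ⟨Or.inr rfl, hpU.2⟩) (Or.inl ⟨Or.inl rfl, hqU.2⟩))
    · exact Or.inr (glue (Or.inl ⟨Or.inl rfl, hpU.2⟩) (Or.inl ⟨Or.inr rfl, hqU.2⟩))
  · rintro ⟨p, hp⟩
    have hp' := hp
    rw [← carpet_spec.2.2.2] at hp'
    obtain ⟨m, q, hq, h⟩ := Set.mem_iUnion.1 hp'
    exact ⟨carpetObj.tmk m ⟨q, hq⟩, Subtype.ext h⟩

theorem SquaSet.isIso_of_bijective {X Y : SquaSet} (f : X ⟶ Y) (hf : Function.Bijective f.toFun) :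
    IsIso f := by
  let e := Equiv.ofBijective f.toFun hf
  refine ⟨⟨⟨e.symm, fun z => ?_⟩, ?_, ?_⟩⟩
  · rw [Equiv.symm_apply_eq]
    exact (f.map_S z).symm
  · ext x
    exact e.symm_apply_apply x
  · ext y
    exact e.apply_symm_apply y

instance isIso_tau : IsIso tau := SquaSet.isIso_of_bijective tau tau_bijective

/-- The coalgebra `(𝕊, τ⁻¹)` for `M ⊗ -` on square sets. -/
def carpetCoalgebra : Endofunctor.Coalgebra SquaSet.tensor where
  V := carpetObj
  str := inv tau

/-! ## The completion functor and the coalgebra `(Q, γ)` -/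

open UniformSpace

namespace SquaMS

/-- The Cauchy completion of a square metric space. -/
def completionObj (X : SquaMS) : SquaMS where
  carrier := Completion X.carrier
  S z := (X.S z : Completion X.carrier)
  S_injective z w h := X.S_injective (Completion.coe_injective _ h)
  dist_le_two x y := by
    induction x, y using Completion.induction_on₂ with
    | hp => exact isClosed_le continuous_dist continuous_const
    | ih x y => rw [Completion.dist_eq]; exact X.dist_le_two x y
  sq1_left r s := by rw [Completion.dist_eq]; exact X.sq1_left r s
  sq1_right r s := by rw [Completion.dist_eq]; exact X.sq1_right r s
  sq1_bottom r s := by rw [Completion.dist_eq]; exact X.sq1_bottom r s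
  sq1_top r s := by rw [Completion.dist_eq]; exact X.sq1_top r s
  sq2 z w := by rw [Completion.dist_eq]; exact X.sq2 z w

theorem Hom.lipschitz {X Y : SquaMS} (f : X ⟶ Y) : LipschitzWith 1 f.toFun :=
  LipschitzWith.of_dist_le_mul fun x y => by simpa using f.short x y

/-- The extension of a short map to the completions. -/
def completionMap {X Y : SquaMS} (f : X ⟶ Y) : X.completionObj ⟶ Y.completionObj where
  toFun := Completion.map f.toFun
  map_S z := by
    change Completion.map f.toFun (X.S z : Completion X.carrier) = (Y.S z : Completion Y.carrier)
    rw [Completion.map_coe (Hom.lipschitz f).uniformContinuous, f.map_S]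
  short x y := by
    have h := (Hom.lipschitz f).completion_map.dist_le_mul x y
    rw [NNReal.coe_one, one_mul] at h
    exact h

/-- The Cauchy completion `C` as an endofunctor on square metric spaces. -/
def completion : SquaMS ⥤ SquaMS where
  obj := completionObj
  map := completionMap
  map_id X := by
    ext x
    exact congrFun Completion.map_id x
  map_comp f g := by
    ext x
    exact (congrFun (Completion.map_comp (Hom.lipschitz g).uniformContinuous
      (Hom.lipschitz f).uniformContinuous) x).symm

/-- The map `x ↦ m ⊗ x`. -/
def incl (X : SquaMS) (m : Idx) (x : X.carrier) : X.tensorObj.carrier := X.tmk m x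

theorem dist_incl (X : SquaMS) (m : Idx) (x y : X.carrier) :
    dist (X.incl m x) (X.incl m y) = X.pathDist (m, x) (m, y) := rfl

theorem lipschitz_incl (X : SquaMS) (m : Idx) :
    LipschitzWith (1 / 3) (X.incl m) :=
  LipschitzWith.of_dist_le_mul fun x y => by
    refine (X.pathDist_same_le m x y).trans (le_of_eq ?_)
    push_cast
    ring

theorem antilipschitz_incl (X : SquaMS) (m : Idx) :
    AntilipschitzWith 6 (X.incl m) :=
  AntilipschitzWith.of_le_mul_dist fun x y => by
    have h := X.dist_le_pathDist m x y
    rw [dist_incl]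
    push_cast
    linarith

/-- The map `δ_X : M ⊗ C(X) → C(M ⊗ X)`, which sends `m ⊗ (x₀, x₁, …)` to the class of the Cauchy
sequence `(m ⊗ x₀, m ⊗ x₁, …)`. -/
def deltaFun (X : SquaMS) :
    X.completionObj.tensorObj.carrier → X.tensorObj.completionObj.carrier :=
  Quotient.lift (fun p : Idx × X.completionObj.carrier =>
    (Completion.map (X.incl p.1) p.2 :
      Completion X.tensorObj.carrier)) (by
    rintro ⟨m, x⟩ ⟨n, y⟩ h
    rcases X.completionObj.glueSetoid_iff.1 h with h | ⟨z, w, h1, h2, h3⟩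
    · rw [h]
    · simp only at h1 h2 h3
      subst h1 h2
      change Completion.map _ (X.S z : Completion X.carrier) =
        Completion.map _ (X.S w : Completion X.carrier)
      rw [Completion.map_coe (X.lipschitz_incl m).uniformContinuous,
        Completion.map_coe (X.lipschitz_incl n).uniformContinuous]
      exact congrArg _ (X.tmk_eq_iff.2 (Or.inr ⟨z, w, rfl, rfl, h3⟩)))

theorem deltaFun_coe (X : SquaMS) (m : Idx) (x : X.carrier) :
    X.deltaFun (X.completionObj.incl m (x : Completion X.carrier)) =
      (X.incl m x : Completion X.tensorObj.carrier) :=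
  Completion.map_coe (X.lipschitz_incl m).uniformContinuous x

theorem deltaFun_short (X : SquaMS) (a b : X.completionObj.tensorObj.carrier) :
    dist (X.deltaFun a) (X.deltaFun b) ≤ dist a b := by
  refine X.completionObj.tensor_short X.deltaFun (fun m x y => ?_)
    (fun a b => X.tensorObj.completionObj.dist_le_two _ _) a b
  have h := (X.lipschitz_incl m).completion_map.dist_le_mul x y
  have h3 : ((1 / 3 : ℝ≥0) : ℝ) = 1 / 3 := by push_cast; rfl
  rw [h3, one_div_mul_eq_div] at h
  exact h

/-- The unit `X → C(X)`. -/
def unit (X : SquaMS) : X ⟶ X.completionObj where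
  toFun x := (x : Completion X.carrier)
  map_S _ := rfl
  short x y := (Completion.dist_eq x y).le

theorem deltaFun_isometry (X : SquaMS) : Isometry X.deltaFun := by
  have hdense : DenseRange (fun a => (tensorMap X.unit).toFun a) := by
    intro b
    induction b using Quotient.inductionOn with | h p => ?_
    obtain ⟨m, x⟩ := p
    have h1 : x ∈ closure (Set.range ((↑) : X.carrier → Completion X.carrier)) :=
      Completion.denseRange_coe x
    have h2 := mem_closure_image (X.completionObj.lipschitz_incl m).continuous.continuousAt h1
    refine closure_mono ?_ h2
    rintro _ ⟨_, ⟨y, rfl⟩, rfl⟩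
    exact ⟨X.incl m y, rfl⟩
  have hcont : Continuous X.deltaFun :=
    (LipschitzWith.of_dist_le_mul (K := 1) fun a b => by
      simpa using X.deltaFun_short a b).continuous
  refine Isometry.of_dist_eq fun a b => le_antisymm (X.deltaFun_short a b) ?_
  refine hdense.induction_on₂ (p := fun a b => dist a b ≤ dist (X.deltaFun a) (X.deltaFun b))
    ?_ ?_ a b
  · exact isClosed_le continuous_dist
      ((hcont.comp continuous_fst).dist (hcont.comp continuous_snd))
  · intro a b
    have h : ∀ a, X.deltaFun ((tensorMap X.unit).toFun a) =
        (a : Completion X.tensorObj.carrier) := by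
      intro a
      induction a using Quotient.inductionOn with | h p => exact X.deltaFun_coe p.1 p.2
    rw [h, h]
    exact ((tensorMap X.unit).short a b).trans (Completion.dist_eq a b).ge

theorem deltaFun_surjective (X : SquaMS) : Function.Surjective X.deltaFun := by
  have hclosed : IsClosed (⋃ m : Idx, Set.range
      (Completion.map (X.incl m))) := by
    refine isClosed_iUnion_of_finite fun m => ?_
    have hanti : AntilipschitzWith 6
        (Completion.map (X.incl m)) := by
      refine AntilipschitzWith.of_le_mul_dist fun x y => ?_
      induction x, y using Completion.induction_on₂ with
      | hp =>
        exact isClosed_le continuous_dist (continuous_const.mul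
          ((Completion.continuous_map.comp continuous_fst).dist
            (Completion.continuous_map.comp continuous_snd)))
      | ih x y =>
        rw [Completion.map_coe (X.lipschitz_incl m).uniformContinuous,
          Completion.map_coe (X.lipschitz_incl m).uniformContinuous, Completion.dist_eq,
          Completion.dist_eq]
        exact (X.antilipschitz_incl m).le_mul_dist x y
    exact hanti.isClosed_range (Completion.uniformContinuous_map)
  intro b
  have hb : b ∈ ⋃ m : Idx, Set.range
      (Completion.map (X.incl m)) := by
    refine Completion.induction_on b hclosed fun a => ?_
    induction a using Quotient.inductionOn with | h p => ?_
    exact Set.mem_iUnion.2 ⟨p.1, (p.2 : Completion X.carrier),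
      Completion.map_coe (X.lipschitz_incl p.1).uniformContinuous p.2⟩
  obtain ⟨m, x, hx⟩ := Set.mem_iUnion.1 hb
  exact ⟨X.completionObj.incl m x, hx⟩

/-- The morphism `δ_X : M ⊗ C(X) → C(M ⊗ X)`. -/
def delta (X : SquaMS) :
    tensor.obj (completion.obj X) ⟶ completion.obj (tensor.obj X) where
  toFun := X.deltaFun
  map_S z := X.deltaFun_coe (idxOf z) (X.S (localOf z))
  short := X.deltaFun_short

instance isIso_delta (X : SquaMS) : IsIso X.delta := by
  let e := Equiv.ofBijective X.deltaFun ⟨X.deltaFun_isometry.injective, X.deltaFun_surjective⟩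
  refine ⟨⟨⟨⟨e.symm, fun z => ?_⟩, fun x y => ?_⟩, ?_, ?_⟩⟩
  · exact (Equiv.symm_apply_eq e).2 (X.delta.map_S z).symm
  · obtain ⟨a, rfl⟩ := e.surjective x
    obtain ⟨b, rfl⟩ := e.surjective y
    have h := (X.deltaFun_isometry.dist_eq a b).ge
    have ha := e.symm_apply_apply a
    have hb := e.symm_apply_apply b
    change dist (e.symm (e a)) (e.symm (e b)) ≤ dist (X.deltaFun a) (X.deltaFun b)
    rw [ha, hb]
    exact h
  · ext x
    exact e.symm_apply_apply x
  · ext y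
    exact e.apply_symm_apply y

/-- For an initial algebra `(G, η)` of `M ⊗ -` on square metric spaces, the coalgebra `(Q, γ)` on
square metric spaces: `Q = C(G)` and `γ : C(G) → C(M ⊗ G) ≅ M ⊗ C(G)` is `C(η⁻¹)`. -/
def completionCoalgebra {G : Endofunctor.Algebra tensor} (hG : Limits.IsInitial G) :
    Endofunctor.Coalgebra tensor where
  V := completion.obj G.a
  str := completion.map (Endofunctor.Algebra.Initial.strInv hG) ≫ inv G.a.delta

/-- Forgetting the metric turns coalgebras on square metric spaces into coalgebras on square
sets. -/
def forgetCoalgebra (A : Endofunctor.Coalgebra tensor) :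
    Endofunctor.Coalgebra SquaSet.tensor where
  V := forgetMetric.obj A.V
  str := forgetMetric.map A.str

end SquaMS

end

end SquareSets

/-! An algebra of `M ⊗ -` whose structure map contracts each copy in a complete bounded metric
turns every coalgebra `X` into a contraction of the complete metric space of morphisms from
`X`, so Banach's theorem yields exactly one coalgebra-to-algebra morphism; inverting the
structure map then makes the algebra a final coalgebra. The carpet is such an algebra
because each `σ_m` contracts by `1/3`, and the completion of the initial algebra is one
because short maps `M ⊗ X → X` contract each copy by `1/3`.

The initial algebra consists of the formal expressions `m₁ ⊗ ⋯ ⊗ mₖ ⊗ z` with `z ∈ M₀`.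
These can be evaluated in every algebra, and the supremum of the distances of their values
is a pseudometric whose quotient has exactly the identifications and distances that
initiality requires. -/

namespace SquareSets

open CategoryTheory
open scoped NNReal

noncomputable section

section Corecursive

variable {C : Type*} [Category* C] {F : C ⥤ C}

/-- An algebra of an endofunctor is corecursive if every coalgebra has exactly one
coalgebra-to-algebra morphism to it. -/
def IsCorecursive (A : Endofunctor.Algebra F) : Prop :=
  ∀ X : Endofunctor.Coalgebra F, ∃! f : X.V ⟶ A.a, X.str ≫ F.map f ≫ A.str = f

theorem IsCorecursive.nonempty_isTerminal {Y : C} {e : F.obj Y ≅ Y}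
    (h : IsCorecursive ⟨Y, e.hom⟩) :
    Nonempty (Limits.IsTerminal (⟨Y, e.inv⟩ : Endofunctor.Coalgebra F)) := by
  have hom_iff (X : Endofunctor.Coalgebra F) (f : X.V ⟶ Y) :
      X.str ≫ F.map f = f ≫ e.inv ↔ X.str ≫ F.map f ≫ e.hom = f := by
    rw [← Category.assoc, Iso.eq_comp_inv]
  choose f hf hf_unique using h
  exact ⟨.ofUniqueHom (fun X => ⟨f X, (hom_iff X _).2 (hf X)⟩) fun X g =>
    Endofunctor.Coalgebra.Hom.ext (hf_unique X g.f ((hom_iff X g.f).1 g.h))⟩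

end Corecursive

namespace SquaSet

theorem exists_eq_tmk (X : SquaSet) (t : (tensor.obj X).carrier) : ∃ m x, t = X.tmk m x := by
  obtain ⟨⟨m, x⟩, rfl⟩ := Quotient.exists_rep t
  exact ⟨m, x, rfl⟩

instance nonempty_hom (X Y : SquaSet) : Nonempty (X ⟶ Y) :=
  ⟨⟨Function.extend X.S Y.S fun _ => Y.S (left 0), X.S_injective.extend_apply _ _⟩⟩

variable {X Y : SquaSet} [MetricSpace Y.carrier]

theorem isClosed_range_toFun :
    IsClosed (Set.range fun f : X ⟶ Y => UniformFun.ofFun f.toFun) := by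
  have range_eq : (Set.range fun f : X ⟶ Y => UniformFun.ofFun f.toFun) =
      ⋂ z, {f | UniformFun.toFun f (X.S z) = Y.S z} := by
    ext f
    simp only [Set.mem_range, Set.mem_iInter, Set.mem_ofPred_eq]
    exact ⟨by rintro ⟨f, rfl⟩; exact f.map_S, fun h => ⟨⟨UniformFun.toFun f, h⟩, rfl⟩⟩
  rw [range_eq]
  exact isClosed_iInter fun z =>
    isClosed_eq (UniformFun.uniformContinuous_eval _ _).continuous continuous_const

variable [BoundedSpace Y.carrier]

/-- The uniform metric on the morphisms of square sets into a bounded metric space. -/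
instance homMetric : MetricSpace (X ⟶ Y) :=
  .induced (fun f => UniformFun.ofFun f.toFun) (fun _ _ h => hom_ext (congrFun h)) inferInstance

theorem isometry_toFun : Isometry fun f : X ⟶ Y => UniformFun.ofFun f.toFun :=
  fun _ _ => rfl

instance completeSpace_hom [CompleteSpace Y.carrier] : CompleteSpace (X ⟶ Y) :=
  (completeSpace_iff_isComplete_range isometry_toFun.isUniformInducing).2
    isClosed_range_toFun.isComplete

theorem lipschitzWith_unfold {K : ℝ≥0} {φ : tensor.obj Y ⟶ Y}
    (hφ : ∀ m, LipschitzWith K fun y => φ.toFun (Y.tmk m y)) (c : X ⟶ tensor.obj X) :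
    LipschitzWith K fun f : X ⟶ Y => c ≫ tensor.map f ≫ φ := by
  refine fun f g => UniformFun.edist_le.2 fun x => ?_
  obtain ⟨m, y, hx⟩ := X.exists_eq_tmk (c.toFun x)
  have unfold_apply (f : X ⟶ Y) : (c ≫ tensor.map f ≫ φ).toFun x = φ.toFun (Y.tmk m (f.toFun y)) :=
    congrArg (fun t => φ.toFun ((tensor.map f).toFun t)) hx
  calc edist ((c ≫ tensor.map f ≫ φ).toFun x) ((c ≫ tensor.map g ≫ φ).toFun x)
      = edist (φ.toFun (Y.tmk m (f.toFun y))) (φ.toFun (Y.tmk m (g.toFun y))) := by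
        rw [unfold_apply, unfold_apply]
    _ ≤ K * edist (f.toFun y) (g.toFun y) := hφ m _ _
    _ ≤ K * edist f g := by gcongr; exact UniformFun.edist_eval_le (f := .ofFun f.toFun)

theorem isCorecursive_of_lipschitzWith [CompleteSpace Y.carrier] {K : ℝ≥0} (hK : K < 1)
    {φ : tensor.obj Y ⟶ Y} (hφ : ∀ m, LipschitzWith K fun y => φ.toFun (Y.tmk m y)) :
    IsCorecursive (⟨Y, φ⟩ : Endofunctor.Algebra tensor) := fun X =>
  have contracting : ContractingWith K fun f : X.V ⟶ Y => X.str ≫ tensor.map f ≫ φ :=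
    ⟨hK, lipschitzWith_unfold hφ X.str⟩
  ⟨_, contracting.fixedPoint_isFixedPt, fun _ hf => contracting.fixedPoint_unique hf⟩

end SquaSet

theorem lipschitzWith_contract (m : Idx) : LipschitzWith (1 / 3) (contract m) :=
  .of_dist_le_mul fun p q => by
    rw [NNReal.coe_div, NNReal.coe_one, NNReal.coe_ofNat, one_div_mul_eq_div]
    exact dist_contract m p q

theorem nonempty_isTerminal_carpetCoalgebra : Nonempty (Limits.IsTerminal carpetCoalgebra) := by
  let _ : MetricSpace carpetObj.carrier := inferInstanceAs (MetricSpace carpet)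
  have : CompactSpace carpetObj.carrier := isCompact_iff_compactSpace.1 carpet_spec.2.1
  exact IsCorecursive.nonempty_isTerminal (e := asIso tau)
    (SquaSet.isCorecursive_of_lipschitzWith (K := 1 / 3) (by norm_num)
      fun m _ _ => lipschitzWith_contract m _ _)

namespace SquaMS

instance boundedSpace (X : SquaMS) : BoundedSpace X.carrier :=
  ⟨Metric.isBounded_iff.2 ⟨2, fun x _ y _ => X.dist_le_two x y⟩⟩

theorem lipschitzWith_tmk {X Y : SquaMS} (φ : tensor.obj X ⟶ Y) (m : Idx) :
    LipschitzWith (1 / 3) fun x => φ.toFun (X.tmk m x) :=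
  one_mul (1 / 3 : ℝ≥0) ▸ φ.lipschitz.comp (X.lipschitz_incl m)

theorem nonempty_isTerminal_forgetCoalgebra {X : SquaMS} [CompleteSpace X.carrier]
    (e : tensor.obj X ≅ X) :
    Nonempty (Limits.IsTerminal (forgetCoalgebra ⟨X, e.inv⟩)) :=
  IsCorecursive.nonempty_isTerminal (e := forgetMetric.mapIso e)
    (SquaSet.isCorecursive_of_lipschitzWith (K := 1 / 3) (by norm_num) (lipschitzWith_tmk e.hom))

theorem nonempty_isTerminal_completionCoalgebra {G : Endofunctor.Algebra tensor}
    (hG : Limits.IsInitial G) :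
    Nonempty (Limits.IsTerminal (forgetCoalgebra (completionCoalgebra hG))) :=
  have : CompleteSpace (completion.obj G.a).carrier :=
    inferInstanceAs (CompleteSpace (UniformSpace.Completion G.a.carrier))
  let η : tensor.obj G.a ≅ G.a :=
    ⟨G.str, Endofunctor.Algebra.Initial.strInv hG, Endofunctor.Algebra.Initial.right_inv hG,
      Endofunctor.Algebra.Initial.left_inv hG⟩
  nonempty_isTerminal_forgetCoalgebra (asIso G.a.delta ≪≫ completion.mapIso η)

/-- The algebra of `M ⊗ -` whose structure map is `m ⊗ x ↦ σ m x`. -/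
def algebraOfMaps (X : SquaMS) (σ : Idx → X.carrier → X.carrier)
    (glue : ∀ {m n : Idx} {z w : M0}, contract m z = contract n w → σ m (X.S z) = σ n (X.S w))
    (map_S : ∀ z, σ (idxOf z) (X.S (localOf z)) = X.S z)
    (dist_le : ∀ m x y, dist (σ m x) (σ m y) ≤ dist x y / 3) : Endofunctor.Algebra tensor where
  a := X
  str :=
    let str : X.tensorObj.carrier → X.carrier := Quotient.lift (fun p => σ p.1 p.2) (by
      rintro ⟨m, _⟩ ⟨n, _⟩ h
      rcases X.glueSetoid_iff.1 h with h | ⟨z, w, rfl, rfl, h⟩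
      · rw [h]
      · exact glue h)
    { toFun := str
      map_S := map_S
      short := X.tensor_short str dist_le fun _ _ => X.dist_le_two _ _ }

/-- The unit square with the taxicab metric. -/
def taxiSquare : SquaMS where
  carrier := unitSquare
  S := Set.inclusion boundary_subset
  S_injective := Set.inclusion_injective _
  metric :=
    { dist p q := taxi p q
      dist_self p := by simp [taxi]
      dist_comm p q := taxi_comm p q
      dist_triangle p q r := taxi_triangle p q r
      eq_of_dist_eq_zero h := Subtype.ext (eq_of_taxi_eq_zero h) }
  dist_le_two p q := taxi_le_two p.2 q.2
  sq1_left r s := by change taxi (left r) (left s) = _; simp [taxi, left, abs_sub_comm]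
  sq1_right r s := by change taxi (right r) (right s) = _; simp [taxi, right, abs_sub_comm]
  sq1_bottom r s := by change taxi (bottom r) (bottom s) = _; simp [taxi, bottom, abs_sub_comm]
  sq1_top r s := by change taxi (top r) (top s) = _; simp [taxi, top, abs_sub_comm]
  sq2 _ _ := le_rfl

instance nonempty_algebra : Nonempty (Endofunctor.Algebra tensor) :=
  ⟨taxiSquare.algebraOfMaps (fun m p => ⟨contract m p.1, contract_mem m p.2⟩)
    (fun h => Subtype.ext h)
    (fun z => Subtype.ext (contract_localOf z))
    fun m p q => (taxi_contract m p.1 q.1).le⟩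

end SquaMS

/-- The formal expressions `m₁ ⊗ ⋯ ⊗ mₖ ⊗ z` with `z ∈ M₀`, from which the initial algebra is
made. -/
inductive Address : Type
  | boundary (z : M0) : Address
  | tensor (m : Idx) (a : Address) : Address

namespace Address

/-- The value of a formal expression in an algebra. -/
def eval (A : Endofunctor.Algebra SquaMS.tensor) : Address → A.a.carrier
  | boundary z => A.a.S z
  | tensor m a => A.str.toFun (A.a.tmk m (eval A a))

theorem bddAbove_dist_eval (a b : Address) :
    BddAbove (Set.range fun A => dist (eval A a) (eval A b)) :=
  ⟨2, Set.forall_mem_range.2 fun A => A.a.dist_le_two _ _⟩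

/-- The smallest pseudometric for which the evaluations in all algebras are short. -/
instance : PseudoMetricSpace Address where
  dist a b := ⨆ A, dist (eval A a) (eval A b)
  dist_self a := by simp only [dist_self, ciSup_const]
  dist_comm a b := by simp only [dist_comm]
  dist_triangle a b c := ciSup_le fun A => (dist_triangle _ (eval A b) _).trans <|
    add_le_add (le_ciSup (bddAbove_dist_eval a b) A) (le_ciSup (bddAbove_dist_eval b c) A)

theorem dist_eval_le (A : Endofunctor.Algebra SquaMS.tensor) (a b : Address) :
    dist (eval A a) (eval A b) ≤ dist a b :=
  le_ciSup (bddAbove_dist_eval a b) A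

theorem dist_le {a b : Address} {C : ℝ} (h : ∀ A, dist (eval A a) (eval A b) ≤ C) :
    dist a b ≤ C :=
  ciSup_le h

theorem le_dist {a b : Address} {C : ℝ} (h : ∀ A, C ≤ dist (eval A a) (eval A b)) :
    C ≤ dist a b :=
  (h (Classical.arbitrary _)).trans (dist_eval_le _ a b)

theorem dist_eq {a b : Address} {C : ℝ} (h : ∀ A, dist (eval A a) (eval A b) = C) :
    dist a b = C :=
  le_antisymm (dist_le fun A => (h A).le) (le_dist fun A => (h A).ge)

theorem inseparable_of_eval_eq {a b : Address} (h : ∀ A, eval A a = eval A b) :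
    Inseparable a b :=
  Metric.inseparable_iff.2 (dist_eq fun A => dist_eq_zero.2 (h A))

theorem continuous_eval (A : Endofunctor.Algebra SquaMS.tensor) : Continuous (eval A) :=
  (LipschitzWith.mk_one (dist_eval_le A)).continuous

theorem dist_tensor_le (m : Idx) (a b : Address) :
    dist (tensor m a) (tensor m b) ≤ dist a b / 3 :=
  dist_le fun A =>
    calc dist (eval A (tensor m a)) (eval A (tensor m b))
        ≤ dist (A.a.incl m (eval A a)) (A.a.incl m (eval A b)) := A.str.short _ _
      _ ≤ dist (eval A a) (eval A b) / 3 := A.a.pathDist_same_le m _ _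
      _ ≤ dist a b / 3 := by gcongr; exact dist_eval_le A a b

theorem continuous_tensor (m : Idx) : Continuous (tensor m) :=
  (LipschitzWith.mk_one fun a b => (dist_tensor_le m a b).trans
    (div_le_self dist_nonneg (by norm_num))).continuous

theorem eval_tensor_boundary_congr (A : Endofunctor.Algebra SquaMS.tensor) {m n : Idx} {z w : M0}
    (h : SquareSets.contract m z = SquareSets.contract n w) :
    eval A (tensor m (boundary z)) = eval A (tensor n (boundary w)) :=
  congrArg A.str.toFun (A.a.tmk_eq_iff.2 (.inr ⟨z, w, rfl, rfl, h⟩))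

theorem eval_tensor_localOf (A : Endofunctor.Algebra SquaMS.tensor) (z : M0) :
    eval A (tensor (idxOf z) (boundary (localOf z))) = eval A (boundary z) :=
  A.str.map_S z

theorem dist_boundary_eq {z w : M0} {C : ℝ}
    (h : ∀ A : Endofunctor.Algebra SquaMS.tensor, dist (A.a.S z) (A.a.S w) = C) :
    dist (boundary z) (boundary w) = C :=
  dist_eq h

theorem taxi_le_dist_boundary (z w : M0) : taxi z w ≤ dist (boundary z) (boundary w) :=
  le_dist fun A => A.a.sq2 z w

end Address

open SeparationQuotient (mk)

/-- The carrier of the initial algebra: formal expressions, identified if their values agree in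
every algebra. -/
def addressSpace : SquaMS where
  carrier := SeparationQuotient Address
  S z := mk (.boundary z)
  S_injective z w h :=
    have hzw : taxi z w ≤ 0 := (Address.taxi_le_dist_boundary z w).trans_eq <|
      Metric.inseparable_iff.1 (SeparationQuotient.mk_eq_mk.1 h)
    Subtype.ext (SquaMS.eq_of_taxi_eq_zero (hzw.antisymm (SquaMS.taxi_nonneg _ _)))
  dist_le_two := by
    rintro ⟨a⟩ ⟨b⟩
    exact Address.dist_le fun A => A.a.dist_le_two _ _
  sq1_left r s := Address.dist_boundary_eq fun A => A.a.sq1_left r s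
  sq1_right r s := Address.dist_boundary_eq fun A => A.a.sq1_right r s
  sq1_bottom r s := Address.dist_boundary_eq fun A => A.a.sq1_bottom r s
  sq1_top r s := Address.dist_boundary_eq fun A => A.a.sq1_top r s
  sq2 := Address.taxi_le_dist_boundary

/-- The algebra of formal expressions, which is initial; its structure map prefixes an expression
with an index. -/
def addressAlgebra : Endofunctor.Algebra SquaMS.tensor :=
  addressSpace.algebraOfMaps
    (fun m => SeparationQuotient.lift (fun a => mk (.tensor m a)) fun _ _ h =>
      SeparationQuotient.mk_eq_mk.2 (h.map (Address.continuous_tensor m)))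
    (fun h => SeparationQuotient.mk_eq_mk.2 <|
      Address.inseparable_of_eval_eq fun A => Address.eval_tensor_boundary_congr A h)
    (fun z => SeparationQuotient.mk_eq_mk.2 <|
      Address.inseparable_of_eval_eq fun A => Address.eval_tensor_localOf A z)
    (by rintro m ⟨a⟩ ⟨b⟩; exact Address.dist_tensor_le m a b)

/-- The morphism from the algebra of formal expressions given by evaluation. -/
def evalHom (A : Endofunctor.Algebra SquaMS.tensor) : addressAlgebra ⟶ A where
  f :=
    { toFun := SeparationQuotient.lift (X := Address) (Address.eval A) fun _ _ h =>
        (h.map (Address.continuous_eval A)).eq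
      map_S _ := rfl
      short := by
        rintro ⟨a⟩ ⟨b⟩
        exact Address.dist_eval_le A a b }
  h := by
    apply SquaMS.hom_ext
    rintro ⟨m, ⟨a⟩⟩
    rfl

theorem hom_mk_eq_eval {A : Endofunctor.Algebra SquaMS.tensor} (f : addressAlgebra ⟶ A)
    (a : Address) : f.f.toFun (mk a) = a.eval A := by
  induction a with
  | boundary z => exact f.f.map_S z
  | tensor m a ih =>
    calc f.f.toFun (mk (.tensor m a))
        = (SquaMS.tensor.map f.f ≫ A.str).toFun (addressSpace.tmk m (mk a)) := by rw [f.h]; rfl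
      _ = A.str.toFun (A.a.tmk m (f.f.toFun (mk a))) := rfl
      _ = Address.eval A (.tensor m a) := by rw [ih]; rfl

theorem nonempty_isInitial_addressAlgebra : Nonempty (Limits.IsInitial addressAlgebra) :=
  ⟨.ofUniqueHom evalHom fun _ f => Endofunctor.Algebra.Hom.ext <| SquaMS.hom_ext <| by
    rintro ⟨a⟩
    exact hom_mk_eq_eval f a⟩

end

end SquareSets

theorem mainTheorem7 :
    Nonempty (CategoryTheory.Limits.IsTerminal SquareSets.carpetCoalgebra) ∧
      (∃ G : CategoryTheory.Endofunctor.Algebra SquareSets.SquaMS.tensor,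
        Nonempty (CategoryTheory.Limits.IsInitial G)) ∧
      ∀ (G : CategoryTheory.Endofunctor.Algebra SquareSets.SquaMS.tensor)
        (hG : CategoryTheory.Limits.IsInitial G),
        Nonempty (CategoryTheory.Limits.IsTerminal
          (SquareSets.SquaMS.forgetCoalgebra (SquareSets.SquaMS.completionCoalgebra hG))) :=
  ⟨SquareSets.nonempty_isTerminal_carpetCoalgebra,
    ⟨SquareSets.addressAlgebra, SquareSets.nonempty_isInitial_addressAlgebra⟩,
    fun _ hG => SquareSets.SquaMS.nonempty_isTerminal_completionCoalgebra hG⟩
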